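/- Let $N\ge 1$ be an integer and let $K=(a_{ij})_{1\le i,j\le N}$ be the Cartan matrix of $SU(N+1)$, i.e. $a_{ii}=2$, $a_{ij}=-1$ if $|i-j|=1$, and $a_{ij}=0$ otherwise. Let $u=(u_1,\dots,u_N)$, with $u_i\in C^2(\mathbb R^2;\mathbb R)$, satisfy $$-\tfrac12\,\Delta u_i=\sum_{j=1}^N a_{ij}\,e^{u_j}\quad\text{in }\mathbb R^2,\qquad \int_{\mathbb R^2}e^{u_i}<\infty,\qquad i=1,\dots,N,$$ and put $$\gamma_i=\frac1\pi\sum_{j=1}^N a_{ij}\int_{\mathbb R^2}e^{u_j},\qquad i=1,\dots,N.$$ Then for every $i\in\{1,\dots,N\}$ there is a constant $a_i\in\mathbb R$ such that $$u_i(z)=-\gamma_i\log|z|+a_i+O(|z|^{-1})\qquad\text{as }|z|\to\infty .$$ Moreover, $\gamma_i>2$ for every $i\in\{1,\dots,N\}$. -/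

import Mathlib

open scoped Laplacian Asymptotics

/-- A `C²` solution `u = (u_1, …, u_N)` on the whole plane `ℝ² = ℂ` of the Toda system for
`SU(N+1)`, `-(1/2) Δ u_i = ∑ j, a_ij e^{u_j}`, where `(a_ij)` is the Cartan matrix of
type `A_N` (the Cartan matrix for `SU(N+1)`). -/
structure IsTodaSolution {N : ℕ} (u : Fin N → ℂ → ℝ) : Prop where
  contDiff : ∀ i, ContDiff ℝ 2 (u i)
  eqn : ∀ i z, -(1 / 2 : ℝ) * (Δ (u i)) z =
    ∑ j, (CartanMatrix.A N i j : ℝ) * Real.exp (u j z)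

/-- Finite energy: `∫ e^{u_i} < ∞` for every `i`. -/
def HasFiniteEnergy {N : ℕ} (u : Fin N → ℂ → ℝ) : Prop :=
  ∀ i, MeasureTheory.Integrable (fun z : ℂ => Real.exp (u i z)) MeasureTheory.volume

/-- `γ_i = (1/π) ∑ j, a_ij ∫ e^{u_j}`. -/
noncomputable def todaGamma {N : ℕ} (u : Fin N → ℂ → ℝ) (i : Fin N) : ℝ :=
  (1 / Real.pi) * ∑ j, (CartanMatrix.A N i j : ℝ) * ∫ z : ℂ, Real.exp (u j z)

/-!
The idea is that a solution of the Toda system is a flat unitary connection, and that finite energy makes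
the associated holomorphic data polynomial.

There are functions `t_0, …, t_N` with `t_k - t_{k+1} = u_{k+1}` and `t_0 + ⋯ + t_N = 0`. They solve the
open Toda lattice `Δ t_k = 2 (e^{u_k} - e^{u_{k+1}})`, where the exponentials with index `0` or `N + 1` are
replaced by zero (`laplacian_todaDiag`). This system says exactly that a certain skew-Hermitian connection
`P dx + Q dy` on the trivial bundle `ℂ^{N+1}` is flat (`todaConnection_flat`): its diagonal part is built
from the gradients of the `t_k`, and its off-diagonal entries are `e^{(t_k - t_{k+1})/2} / √2` up to a
factor. The coefficients are only `C¹`, which suffices for a global flat frame, obtained by parallel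
transport along rays (`exists_flat_frame`); this frame is unitary (`frame_unitary`). The minors of its
first `k` rows, multiplied by `exp (-(t_0 + ⋯ + t_{k-1}) / 2)`, are entire functions, and by the
Cauchy–Binet formula the sum of their squared absolute values is `k! exp (-(t_0 + ⋯ + t_{k-1}))`
(`exists_entire_sum_norm_sq`).

For the growth of these entire functions, averages over discs suffice. Since `u⁺ ≤ e^u` and the Laplacian
of each `u_i` is integrable, Green's formula shows that the averages of `|u_i|` over discs grow at most
logarithmically in the radius (`integral_abs_radialMean_le`). The function `-(t_0 + ⋯ + t_{k-1})` is
subharmonic, with Laplacian `2 e^{u_k}`, so the sub-mean value property turns this into a pointwise upper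
bound by a multiple of the logarithm (`le_log_of_subharmonic`). Hence the entire functions are polynomials
(`exists_polynomial_of_growth`). The logarithm of a sum of squared absolute values of polynomials equals
`2 d log |z| + c + O(|z|⁻¹)` (`log_sum_norm_sq_polynomial`), and each `u_i` is a linear combination of
three such logarithms and a constant.

The coefficient of the logarithm is identified with `-γ_i` by computing the growth rate of the averages of
`u_i` in two ways (`tendsto_radialMean_add_one_sub`, `tendsto_radialMean_add_one_sub_of_log`). Finally
`γ_i > 2`, because `e^{u_i}` is integrable and `|z|⁻²` is not integrable at infinity in the plane
(`two_lt_of_integrable_exp`).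
-/

open Set Filter Topology MeasureTheory

/-! ### Linear differential equations in a Banach algebra -/

section LinearODE

variable {𝔸 : Type*} [NormedRing 𝔸] [NormedAlgebra ℝ 𝔸]

/-- The Picard iterates of the linear equation `Φ' = a Φ` with initial value `1` at time `0`. -/
noncomputable def picardTerm (a : ℝ → 𝔸) : ℕ → ℝ → 𝔸
  | 0 => fun _ => 1
  | n + 1 => fun t => ∫ s in (0 : ℝ)..t, a s * picardTerm a n s

lemma continuous_picardTerm {a : ℝ → 𝔸} (ha : Continuous a) (n : ℕ) :
    Continuous (picardTerm a n) := by
  induction n with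
  | zero => exact continuous_const
  | succ n ih =>
    exact intervalIntegral.continuous_primitive (μ := volume)
      (fun _ _ => (ha.mul ih).intervalIntegrable _ _) 0

lemma hasDerivAt_picardTerm_succ [CompleteSpace 𝔸] {a : ℝ → 𝔸} (ha : Continuous a) (n : ℕ) (t : ℝ) :
    HasDerivAt (picardTerm a (n + 1)) (a t * picardTerm a n t) t :=
  intervalIntegral.integral_hasDerivAt_right
    ((ha.mul (continuous_picardTerm ha n)).intervalIntegrable _ _)
    ((ha.mul (continuous_picardTerm ha n)).stronglyMeasurableAtFilter _ _)
    (ha.mul (continuous_picardTerm ha n)).continuousAt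

lemma norm_picardTerm_le {a : ℝ → 𝔸} {K : ℝ} (hK : ∀ t, ‖a t‖ ≤ K) (n : ℕ) (t : ℝ) :
    ‖picardTerm a n t‖ ≤ ‖(1 : 𝔸)‖ * (K ^ n * |t| ^ n / n.factorial) := by
  have hK0 : 0 ≤ K := (norm_nonneg _).trans (hK 0)
  induction n generalizing t with
  | zero => simp [picardTerm]
  | succ n ih =>
    have h1 : ∀ s, ‖a s * picardTerm a n s‖ ≤
        K * (‖(1 : 𝔸)‖ * (K ^ n / n.factorial)) * |s - 0| ^ n := fun s => by
      refine (norm_mul_le _ _).trans ?_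
      refine (mul_le_mul (hK s) (ih s) (norm_nonneg _) hK0).trans (le_of_eq ?_)
      rw [sub_zero]; ring
    calc ‖picardTerm a (n + 1) t‖
        = ‖∫ s in (0 : ℝ)..t, a s * picardTerm a n s‖ := rfl
      _ ≤ |∫ s in (0 : ℝ)..t, K * (‖(1 : 𝔸)‖ * (K ^ n / n.factorial)) * |s - 0| ^ n| :=
        intervalIntegral.norm_integral_le_abs_of_norm_le
          (Eventually.of_forall fun s => h1 s) (Continuous.intervalIntegrable (by fun_prop) _ _)
      _ = ‖(1 : 𝔸)‖ * (K ^ (n + 1) * |t| ^ (n + 1) / (n + 1).factorial) := by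
        rw [intervalIntegral.abs_integral_eq_abs_integral_uIoc, integral_const_mul,
          integral_pow_abs_sub_uIoc, sub_zero, abs_of_nonneg (by positivity), Nat.factorial_succ]
        push_cast
        field_simp
        ring

/-- Global solvability of the linear equation `Φ' = a Φ`, by summing the Picard iterates. -/
theorem exists_hasDerivAt_linear [CompleteSpace 𝔸] {a : ℝ → 𝔸} (ha : Continuous a) {K : ℝ}
    (hK : ∀ t, ‖a t‖ ≤ K) :
    ∃ Φ : ℝ → 𝔸, Φ 0 = 1 ∧ ∀ t, HasDerivAt Φ (a t * Φ t) t := by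
  have hK0 : 0 ≤ K := (norm_nonneg _).trans (hK 0)
  have hsum : ∀ t, Summable fun n => picardTerm a n t := fun t => by
    refine Summable.of_norm_bounded (g := fun n => ‖(1 : 𝔸)‖ * ((K * |t|) ^ n / n.factorial))
      ((Real.summable_pow_div_factorial _).mul_left _) fun n => ?_
    simpa [mul_pow] using norm_picardTerm_le hK n t
  have h0 : ∀ n, picardTerm a (n + 1) 0 = 0 := fun n => by simp [picardTerm]
  refine ⟨fun t => 1 + ∑' n, picardTerm a (n + 1) t, by simp [h0], fun t => ?_⟩
  have key := hasDerivAt_tsum_of_isPreconnected (𝕜 := ℝ)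
    (g := fun n => picardTerm a (n + 1)) (g' := fun n t => a t * picardTerm a n t)
    (u := fun n => K * (‖(1 : 𝔸)‖ * ((K * (|t| + 1)) ^ n / n.factorial)))
    (t := Metric.ball 0 (|t| + 1)) (y₀ := 0) (y := t)
    (((Real.summable_pow_div_factorial _).mul_left _).mul_left _) Metric.isOpen_ball
    (convex_ball _ _).isPreconnected
    (fun n y _ => hasDerivAt_picardTerm_succ ha n y)
    (fun n y hy => by
      have hy' : |y| ≤ |t| + 1 := by simpa using (Metric.mem_ball.1 hy).le
      refine (norm_mul_le _ _).trans
        (mul_le_mul (hK y) ((norm_picardTerm_le hK n y).trans ?_) (norm_nonneg _) hK0)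
      rw [mul_pow]
      gcongr)
    (Metric.mem_ball_self (by positivity)) (by simp [h0])
    (by simp)
  have h1 := key.const_add 1
  rwa [(hsum t).tsum_mul_left, (hsum t).tsum_eq_zero_add] at h1

/-- The algebra behind the comparison of parallel transports along two nearby rays: if the curvature
of the connection vanishes, the first-order ansatz solves the transport equation along the perturbed
ray up to terms of second order. -/
lemma transport_defect (t : ℝ) {wz wh Dzh Dhz Dhh r φ : 𝔸}
    (hflat : Dzh - Dhz + wh * wz - wz * wh = 0) :
    (wh + t • Dzh) * φ + (1 + t • wh) * (wz * φ)
        - (wz + wh + t • Dhz + t • Dhh + r) * ((1 + t • wh) * φ) =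
      -(t • (wh * wh) + (t • Dhh) * (1 + t • wh) + (t • Dhz) * (t • wh) + r * (1 + t • wh)) * φ := by
  have h : Dzh = Dhz - wh * wz + wz * wh := by
    rw [← sub_eq_zero, ← hflat]; abel
  subst h
  simp only [add_mul, mul_add, neg_mul, sub_mul, smul_mul_assoc, mul_smul_comm, mul_assoc, one_mul,
    mul_one, smul_add, smul_sub, neg_add]
  module

lemma gronwallBound_zero_eq_mul (K ε x : ℝ) :
    gronwallBound 0 K ε x = ε * gronwallBound 0 K 1 x := by
  rcases eq_or_ne K 0 with rfl | hK
  · simp [gronwallBound_K0]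
  · simp only [gronwallBound_of_K_ne_0 hK]; ring

end LinearODE

/-! ### Flat connections -/

section Frame

variable {E : Type*} [NormedAddCommGroup E] [NormedSpace ℝ E] [ProperSpace E]
  {𝔸 : Type*} [NormedRing 𝔸] [NormedAlgebra ℝ 𝔸] [CompleteSpace 𝔸]

/-- **Frobenius theorem for linear systems.** A `C¹` connection form `ω` with vanishing curvature has
a global flat frame `Ψ`, that is, a solution of `dΨ = ω Ψ`. The frame at `z` is the parallel transport
along the segment from `0` to `z`. -/
theorem exists_flat_frame {ω : E → E →L[ℝ] 𝔸} (hω : ContDiff ℝ 1 ω)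
    (hflat : ∀ z v h, fderiv ℝ ω z v h - fderiv ℝ ω z h v + ω z h * ω z v - ω z v * ω z h = 0) :
    ∃ Ψ : E → 𝔸, Ψ 0 = 1 ∧
      ∀ z, HasFDerivAt Ψ (((ContinuousLinearMap.mul ℝ 𝔸).flip (Ψ z)).comp (ω z)) z := by
  have hωc : Continuous ω := hω.continuous
  have hωd : Differentiable ℝ ω := hω.differentiable (by norm_num)
  have hDc : Continuous (fderiv ℝ ω) := hω.continuous_fderiv (by norm_num)
  -- The time is clamped to `[0, 1]`, which makes the coefficients of the transport equation bounded.
  let c : ℝ → ℝ := fun t => max 0 (min t 1)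
  have hc : Continuous c := by fun_prop
  have hc0 : ∀ t, 0 ≤ c t := fun t => le_max_left _ _
  have hc1 : ∀ t, c t ≤ 1 := fun t => max_le zero_le_one (min_le_right _ _)
  have hcc : ∀ t, 0 ≤ t → t ≤ 1 → c t = t := fun t h0 h1 => by simp [c, h0, h1]
  have hball : ∀ (x : E) (R : ℝ), ‖x‖ ≤ R → ∀ t : ℝ, 0 ≤ t → t ≤ 1 → ‖t • x‖ ≤ R :=
      fun x R hx t h0 h1 => by
    rw [norm_smul, Real.norm_of_nonneg h0]
    exact (mul_le_of_le_one_left (norm_nonneg _) h1).trans hx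
  have hbd : ∀ R : ℝ, ∃ M, 0 ≤ M ∧ ∀ x : E, ‖x‖ ≤ R → ‖ω x‖ ≤ M ∧ ‖fderiv ℝ ω x‖ ≤ M := fun R => by
    obtain ⟨M1, h1⟩ := (isCompact_closedBall (0 : E) R).exists_bound_of_continuousOn
      (f := ω) (Continuous.continuousOn hωc)
    obtain ⟨M2, h2⟩ := (isCompact_closedBall (0 : E) R).exists_bound_of_continuousOn
      (f := fderiv ℝ ω) (Continuous.continuousOn hDc)
    refine ⟨max 0 (max M1 M2), le_max_left _ _, fun x hx => ?_⟩
    have hx' : x ∈ Metric.closedBall (0 : E) R := by simpa using hx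
    exact ⟨(h1 x hx').trans (by simp), (h2 x hx').trans (by simp)⟩
  have hex : ∀ z : E, ∃ Φ : ℝ → 𝔸, Φ 0 = 1 ∧ ∀ t, HasDerivAt Φ (ω (c t • z) z * Φ t) t := fun z => by
    obtain ⟨M, -, hM⟩ := hbd ‖z‖
    refine exists_hasDerivAt_linear (a := fun t => ω (c t • z) z) (K := M * ‖z‖) ?_ fun t => ?_
    · exact (hωc.comp (hc.smul continuous_const)).clm_apply continuous_const
    · exact ((ω _).le_opNorm z).trans (mul_le_mul_of_nonneg_right
        (hM _ (hball z _ le_rfl _ (hc0 t) (hc1 t))).1 (norm_nonneg _))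
  choose Φ hΦ0 hΦ using hex
  refine ⟨fun z => Φ z 1, ?_, fun z => ?_⟩
  · have : ∀ t, HasDerivAt (Φ 0) 0 t := fun t => by simpa using hΦ 0 t
    rw [← hΦ0 0]
    exact is_const_of_deriv_eq_zero (fun t => (this t).differentiableAt) (fun t => (this t).deriv) 1 0
  obtain ⟨M, hM0, hM⟩ := hbd (‖z‖ + 1)
  obtain ⟨C, hC⟩ := (isCompact_Icc (a := (0 : ℝ)) (b := 1)).exists_bound_of_continuousOn
    (continuous_iff_continuousAt.2 fun t => (hΦ z t).continuousAt).continuousOn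
  have hC0 : 0 ≤ C := (norm_nonneg _).trans (hC 0 (by simp))
  set n1 := ‖(1 : 𝔸)‖ with hn1
  set A := M * M + M * (n1 + M) + M * ‖z‖ * M + (‖z‖ + 1) * (n1 + M) with hA
  have hA0 : 0 ≤ A := by positivity
  set G := gronwallBound 0 (M * (‖z‖ + 1)) 1 1 with hG
  have hG0 : 0 ≤ G := by
    have := (gronwallBound_mono (δ := 0) (ε := 1) (K := M * (‖z‖ + 1)) le_rfl zero_le_one
      (by positivity)) (zero_le_one)
    rwa [gronwallBound_x0] at this
  rw [hasFDerivAt_iff_isLittleO_nhds_zero, Asymptotics.isLittleO_iff]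
  intro ε' hε'
  set ε := ε' / (A * C * G + 1) with hε
  have hεpos : 0 < ε := by positivity
  obtain ⟨δ, hδ, huc⟩ := (Metric.uniformContinuousOn_iff (f := fderiv ℝ ω)).1
    ((isCompact_closedBall (0 : E) (‖z‖ + 1)).uniformContinuousOn_of_continuous
      (f := fderiv ℝ ω) (Continuous.continuousOn hDc)) ε hεpos
  have hmin : 0 < min δ (min ε 1) := by positivity
  filter_upwards [Metric.ball_mem_nhds (0 : E) hmin] with h hh
  rw [mem_ball_zero_iff, lt_min_iff, lt_min_iff] at hh
  obtain ⟨hhδ, hhε, hh1⟩ := hh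
  have hzh : ‖z + h‖ ≤ ‖z‖ + 1 := (norm_add_le _ _).trans (by linarith)
  -- The first-order ansatz for the transport along the ray through `z + h`.
  let Θ : ℝ → 𝔸 := fun t => (1 + t • ω (t • z) h) * Φ z t
  have hΘ : ∀ t, HasDerivAt Θ ((ω (t • z) h + t • fderiv ℝ ω (t • z) z h) * Φ z t +
      (1 + t • ω (t • z) h) * (ω (c t • z) z * Φ z t)) t := fun t => by
    have h1 : HasDerivAt (fun s : ℝ => ω (s • z)) (fderiv ℝ ω (t • z) z) t := by
      have h2 : HasDerivAt (fun s : ℝ => s • z) z t := by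
        simpa using (hasDerivAt_id t).smul_const z
      exact (hωd (t • z)).hasFDerivAt.comp_hasDerivAt t h2
    have h3 : HasDerivAt (fun s : ℝ => ω (s • z) h) (fderiv ℝ ω (t • z) z h) t := by
      simpa using h1.clm_apply (hasDerivAt_const t h)
    have h4 := ((hasDerivAt_id t).smul h3).const_add (1 : 𝔸)
    refine (h4.mul (hΦ z t)).congr_deriv ?_
    simp [add_comm]
  have hdef : ∀ t ∈ Ico (0 : ℝ) 1, dist ((ω (t • z) h + t • fderiv ℝ ω (t • z) z h) * Φ z t +
      (1 + t • ω (t • z) h) * (ω (c t • z) z * Φ z t)) (ω (c t • (z + h)) (z + h) * Θ t) ≤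
      ε * ‖h‖ * (A * C) := fun t ht => by
    have ht0 := ht.1
    have ht1 := ht.2.le
    rw [hcc t ht0 ht1, dist_eq_norm]
    have htz : ‖t • z‖ ≤ ‖z‖ + 1 := hball z _ (by linarith) t ht0 ht1
    have htzh : ‖t • (z + h)‖ ≤ ‖z‖ + 1 := hball _ _ hzh t ht0 ht1
    set ρ := ω (t • (z + h)) - ω (t • z) - fderiv ℝ ω (t • z) (t • h) with hρ
    have hρn : ‖ρ‖ ≤ ε * ‖h‖ := by
      have hth : ‖t • h‖ ≤ ‖h‖ := hball h _ le_rfl t ht0 ht1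
      have hsub : t • (z + h) - t • z = t • h := by rw [smul_add]; abel
      have hmv := (convex_segment (𝕜 := ℝ) (t • z) (t • (z + h))).norm_image_sub_le_of_norm_fderiv_le'
        (𝕜 := ℝ) (f := ω) (φ := fderiv ℝ ω (t • z)) (C := ε) (fun x _ => hωd x) (fun x hx => ?_)
        (left_mem_segment _ _ _) (right_mem_segment _ _ _)
      · rw [hsub] at hmv
        exact hmv.trans (by gcongr)
      · have hxK : x ∈ Metric.closedBall (0 : E) (‖z‖ + 1) :=
          (convex_closedBall (0 : E) (‖z‖ + 1)).segment_subset (by simpa using htz)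
            (by simpa using htzh) hx
        have hd : dist x (t • z) ≤ ‖h‖ := by
          rw [segment_eq_image'] at hx
          obtain ⟨s, hs, rfl⟩ := hx
          rw [hsub, dist_eq_norm, add_sub_cancel_left]
          exact (hball _ _ le_rfl s hs.1 hs.2).trans hth
        have := huc x hxK (t • z) (by simpa using htz) (hd.trans_lt hhδ)
        exact ((dist_eq_norm (fderiv ℝ ω x) (fderiv ℝ ω (t • z))).symm.trans_lt this).le
    have hWeq : ω (t • (z + h)) (z + h) = ω (t • z) z + ω (t • z) h + t • fderiv ℝ ω (t • z) h z
        + t • fderiv ℝ ω (t • z) h h + ρ (z + h) := by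
      simp only [hρ, map_smul, _root_.sub_apply, _root_.smul_apply, map_add,
        smul_add]
      abel
    rw [hWeq, transport_defect t (hflat (t • z) z h)]
    obtain ⟨hw, hD⟩ := hM _ htz
    have ht' : ‖t‖ ≤ 1 := by rwa [Real.norm_of_nonneg ht0]
    have hsm : ∀ x : 𝔸, ‖t • x‖ ≤ ‖x‖ := fun x => by
      rw [norm_smul]; exact mul_le_of_le_one_left (norm_nonneg _) ht'
    have e1 : ‖ω (t • z) h‖ ≤ M * ‖h‖ := ((ω _).le_opNorm h).trans (by gcongr)
    have e2 : ‖fderiv ℝ ω (t • z) h h‖ ≤ M * ‖h‖ * ‖h‖ :=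
      ((fderiv ℝ ω (t • z)).le_opNorm₂ h h).trans (by gcongr)
    have e3 : ‖fderiv ℝ ω (t • z) h z‖ ≤ M * ‖h‖ * ‖z‖ :=
      ((fderiv ℝ ω (t • z)).le_opNorm₂ h z).trans (by gcongr)
    have e4 : ‖ρ (z + h)‖ ≤ ε * ‖h‖ * (‖z‖ + 1) := (ρ.le_opNorm _).trans (by gcongr)
    have e5 : ‖1 + t • ω (t • z) h‖ ≤ n1 + M := by
      refine (norm_add_le _ _).trans (add_le_add le_rfl ((hsm _).trans (e1.trans ?_)))
      exact mul_le_of_le_one_right hM0 hh1.le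
    have f1 : ‖t • (ω (t • z) h * ω (t • z) h)‖ ≤ M * ‖h‖ * (M * ‖h‖) :=
      (hsm _).trans ((norm_mul_le _ _).trans (by gcongr))
    have f2 : ‖(t • fderiv ℝ ω (t • z) h h) * (1 + t • ω (t • z) h)‖ ≤ M * ‖h‖ * ‖h‖ * (n1 + M) :=
      (norm_mul_le _ _).trans (mul_le_mul ((hsm _).trans e2) e5 (norm_nonneg _) (by positivity))
    have f3 : ‖(t • fderiv ℝ ω (t • z) h z) * (t • ω (t • z) h)‖ ≤ M * ‖h‖ * ‖z‖ * (M * ‖h‖) :=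
      (norm_mul_le _ _).trans (mul_le_mul ((hsm _).trans e3) ((hsm _).trans e1) (norm_nonneg _)
        (by positivity))
    have f4 : ‖ρ (z + h) * (1 + t • ω (t • z) h)‖ ≤ ε * ‖h‖ * (‖z‖ + 1) * (n1 + M) :=
      (norm_mul_le _ _).trans (mul_le_mul e4 e5 (norm_nonneg _) (by positivity))
    refine (norm_mul_le _ _).trans ?_
    rw [norm_neg, ← mul_assoc]
    refine mul_le_mul ?_ (hC t ⟨ht0, ht1⟩) (norm_nonneg _) (by positivity)
    refine (norm_add_le _ _).trans ((add_le_add (norm_add₃_le.trans (add_le_add_three f1 f2 f3))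
      f4).trans ?_)
    have hhh : ‖h‖ * ‖h‖ ≤ ε * ‖h‖ := by gcongr
    calc M * ‖h‖ * (M * ‖h‖) + M * ‖h‖ * ‖h‖ * (n1 + M) + M * ‖h‖ * ‖z‖ * (M * ‖h‖)
          + ε * ‖h‖ * (‖z‖ + 1) * (n1 + M)
        = (M * M + M * (n1 + M) + M * ‖z‖ * M) * (‖h‖ * ‖h‖) + ε * ‖h‖ * ((‖z‖ + 1) * (n1 + M)) := by
          ring
      _ ≤ (M * M + M * (n1 + M) + M * ‖z‖ * M) * (ε * ‖h‖) + ε * ‖h‖ * ((‖z‖ + 1) * (n1 + M)) := by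
          gcongr
      _ = ε * ‖h‖ * A := by rw [hA]; ring
  have hgr := dist_le_of_approx_trajectories_ODE (a := 0) (b := 1) (δ := 0) (εf := 0)
    (v := fun t x => ω (c t • (z + h)) (z + h) * x) (K := ⟨M * (‖z‖ + 1), by positivity⟩)
    (f := Φ (z + h)) (g := Θ) (fun t => LipschitzWith.of_dist_le_mul fun x y => ?_)
    (fun t _ => (hΦ (z + h) t).continuousAt.continuousWithinAt)
    (fun t _ => (hΦ (z + h) t).hasDerivWithinAt) (fun t _ => (dist_self _).le)
    (fun t _ => (hΘ t).continuousAt.continuousWithinAt)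
    (fun t _ => (hΘ t).hasDerivWithinAt) hdef (by simp [Θ, hΦ0]) 1 (by simp)
  · rw [zero_add, sub_zero, gronwallBound_zero_eq_mul, dist_eq_norm] at hgr
    have hΘ1 : Φ (z + h) 1 - Φ z 1 - ((ContinuousLinearMap.mul ℝ 𝔸).flip (Φ z 1)).comp (ω z) h =
        Φ (z + h) 1 - Θ 1 := by
      simp [Θ, add_mul, sub_sub]
    rw [hΘ1]
    refine hgr.trans ?_
    change ε * ‖h‖ * (A * C) * G ≤ _
    calc ε * ‖h‖ * (A * C) * G = ε * (A * C * G) * ‖h‖ := by ring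
      _ ≤ ε * (A * C * G + 1) * ‖h‖ := by gcongr; linarith
      _ = ε' * ‖h‖ := by rw [hε, div_mul_cancel₀ _ (by positivity)]
  · rw [dist_eq_norm, dist_eq_norm, ← mul_sub]
    refine (norm_mul_le _ _).trans (mul_le_mul_of_nonneg_right ?_ (norm_nonneg _))
    exact ((ω _).le_opNorm _).trans (mul_le_mul
      (hM _ (hball _ _ hzh _ (hc0 t) (hc1 t))).1 hzh (norm_nonneg _) hM0)

end Frame

/-! ### The Cauchy–Binet formula -/

section CauchyBinet

open Matrix

variable {R : Type*} [CommRing R] {ι κ : Type*} [Fintype ι] [DecidableEq ι] [Fintype κ]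

lemma det_mul_eq_sum_prod (A : Matrix ι κ R) (B : Matrix κ ι R) :
    (A * B).det = ∑ p : ι → κ, (∏ i, B (p i) i) * (A.submatrix id p).det := by
  classical
  have h : (A * B)ᵀ = fun i => ∑ j, B j i • Aᵀ j := by
    ext i a
    simp [Matrix.mul_apply, Finset.sum_apply, mul_comm]
  rw [← det_transpose, h]
  change (detRowAlternating (R := R) (n := ι)).toMultilinearMap (fun i => ∑ j, B j i • Aᵀ j) = _
  rw [MultilinearMap.map_sum]
  refine Finset.sum_congr rfl fun p _ => ?_
  rw [MultilinearMap.map_smul_univ, smul_eq_mul, ← det_transpose (A.submatrix id p)]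
  rfl

/-- The **Cauchy–Binet formula**, with the sum over all maps `ι → κ` instead of over the subsets of `κ`;
each subset is then counted once for every ordering of it. -/
theorem sum_det_submatrix_mul_det_submatrix (A : Matrix ι κ R) (B : Matrix κ ι R) :
    ∑ p : ι → κ, (A.submatrix id p).det * (B.submatrix p id).det =
      (Fintype.card ι).factorial * (A * B).det := by
  classical
  have h1 : ∀ p : ι → κ, (A.submatrix id p).det * (B.submatrix p id).det =
      ∑ σ : Equiv.Perm ι, (∏ i, B ((p ∘ σ) i) i) * (A.submatrix id (p ∘ σ)).det := fun p => by
    rw [det_apply' (B.submatrix p id), Finset.mul_sum]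
    refine Finset.sum_congr rfl fun σ _ => ?_
    have : (A.submatrix id (p ∘ σ)).det = Equiv.Perm.sign σ * (A.submatrix id p).det := by
      rw [← det_permute' σ (A.submatrix id p)]; rfl
    rw [this]
    simp only [submatrix_apply, id_eq, Function.comp_apply]
    ring
  simp_rw [h1]
  rw [Finset.sum_comm]
  have h2 : ∀ σ : Equiv.Perm ι, ∑ p : ι → κ, (∏ i, B ((p ∘ σ) i) i) * (A.submatrix id (p ∘ σ)).det =
      (A * B).det := fun σ => by
    rw [det_mul_eq_sum_prod]
    exact Fintype.sum_equiv (Equiv.arrowCongr σ.symm (Equiv.refl κ)) _ _ fun p => rfl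
  rw [Finset.sum_congr rfl fun σ _ => h2 σ]
  simp [Fintype.card_perm]

/-- The case `B = Aᴴ` of the Cauchy–Binet formula, for orthonormal rows. -/
theorem sum_norm_sq_det_submatrix {A : Matrix ι κ ℂ} (hA : A * Aᴴ = 1) :
    ∑ p : ι → κ, ‖(A.submatrix id p).det‖ ^ 2 = (Fintype.card ι).factorial := by
  have h := sum_det_submatrix_mul_det_submatrix A Aᴴ
  rw [hA, det_one, mul_one] at h
  have h2 : ∀ p : ι → κ, (Aᴴ.submatrix p id).det = star (A.submatrix id p).det := fun p => by
    rw [← det_conjTranspose, conjTranspose_submatrix]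
  have h3 : ((∑ p : ι → κ, ‖(A.submatrix id p).det‖ ^ 2 : ℝ) : ℂ) = (Fintype.card ι).factorial := by
    rw [← h]
    push_cast
    refine Finset.sum_congr rfl fun p _ => ?_
    rw [h2, ← starRingEnd_apply, Complex.mul_conj']
  exact_mod_cast h3

end CauchyBinet

/-! ### Matrix-valued flat frames -/

section MatrixFrame

open Matrix

/-- The derivative of the determinant is the sum of the determinants with one row differentiated. -/
lemma hasFDerivAt_det {E : Type*} [NormedAddCommGroup E] [NormedSpace ℝ E] {k : ℕ}
    {M : E → Matrix (Fin k) (Fin k) ℂ} {M' : Fin k → Fin k → E →L[ℝ] ℂ} {z : E}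
    (hM : ∀ a b, HasFDerivAt (fun z => M z a b) (M' a b) z) :
    ∃ L : E →L[ℝ] ℂ, HasFDerivAt (fun z => det (M z)) L z ∧
      ∀ v, L v = ∑ a, det (Matrix.updateRow (M z) a (fun b => M' a b v)) := by
  let f : ContinuousMultilinearMap ℝ (fun _ : Fin k => Fin k → ℂ) ℂ :=
    { toMultilinearMap := (detRowAlternating (R := ℂ) (n := Fin k)).toMultilinearMap.restrictScalars ℝ
      cont := by
        change Continuous fun M : Matrix (Fin k) (Fin k) ℂ => M.det
        exact continuous_id.matrix_det }
  let N : E → Fin k → Fin k → ℂ := M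
  have h : HasFDerivAt N (ContinuousLinearMap.pi fun a => ContinuousLinearMap.pi (M' a)) z :=
    hasFDerivAt_pi.2 fun a => hasFDerivAt_pi.2 fun b => hM a b
  refine ⟨_, (f.hasFDerivAt (N z)).comp z h, fun v => ?_⟩
  simp only [ContinuousLinearMap.comp_apply, ContinuousMultilinearMap.linearDeriv_apply]
  rfl

/-- The planar case of `exists_flat_frame` with connection form `P dx + Q dy`, for matrices transported
to an arbitrary normed algebra, so that no particular matrix norm has to be chosen. -/
lemma exists_flat_matrix_frame_of_algEquiv {n : ℕ} {𝔸 : Type*} [NormedRing 𝔸] [NormedAlgebra ℝ 𝔸]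
    [FiniteDimensional ℝ 𝔸] (φ : Matrix (Fin n) (Fin n) ℂ ≃ₐ[ℝ] 𝔸)
    {P Q : ℂ → Matrix (Fin n) (Fin n) ℂ}
    (hP : ∀ a b, ContDiff ℝ 1 fun z => P z a b) (hQ : ∀ a b, ContDiff ℝ 1 fun z => Q z a b)
    (hflat : ∀ z a b, fderiv ℝ (fun z => Q z a b) z 1 - fderiv ℝ (fun z => P z a b) z Complex.I
      + (Q z * P z - P z * Q z) a b = 0) :
    ∃ Ψ : ℂ → Matrix (Fin n) (Fin n) ℂ, Ψ 0 = 1 ∧ ∀ z a b, ∃ L : ℂ →L[ℝ] ℂ,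
      HasFDerivAt (fun z => Ψ z a b) L z ∧
        ∀ v : ℂ, L v = (((v.re : ℂ) • P z + (v.im : ℂ) • Q z) * Ψ z) a b := by
  have : CompleteSpace 𝔸 := FiniteDimensional.complete ℝ 𝔸
  let e : Fin n → Fin n → 𝔸 →L[ℝ] ℂ := fun a b =>
    LinearMap.toContinuousLinearMap ((Matrix.entryLinearMap ℝ ℂ a b).comp φ.symm.toLinearMap)
  have he : ∀ a b M, e a b M = φ.symm M a b := fun a b M => rfl
  have hsum : ∀ {F : ℂ → Matrix (Fin n) (Fin n) ℂ}, (∀ a b, ContDiff ℝ 1 fun z => F z a b) →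
      ContDiff ℝ 1 fun z => φ (F z) := fun {F} hF => by
    have : (fun z => φ (F z)) = fun z => ∑ a, ∑ b, ((F z a b).re • φ (Matrix.single a b (1 : ℂ))
        + (F z a b).im • φ (Matrix.single a b Complex.I)) := by
      ext1 z
      conv_lhs => rw [matrix_eq_sum_single (F z)]
      simp only [map_sum, ← map_smul, ← map_add]
      congr! 5 with a _ b _
      rw [Matrix.smul_single, Matrix.smul_single, ← Matrix.single_add]
      congr 1
      simp
    rw [this]
    refine ContDiff.sum fun a _ => ContDiff.sum fun b _ => ?_
    exact ((Complex.reCLM.contDiff.comp (hF a b)).smul contDiff_const).add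
      ((Complex.imCLM.contDiff.comp (hF a b)).smul contDiff_const)
  set p : ℂ → 𝔸 := fun z => φ (P z) with hp
  set q : ℂ → 𝔸 := fun z => φ (Q z) with hq
  have hp1 : ContDiff ℝ 1 p := hsum hP
  have hq1 : ContDiff ℝ 1 q := hsum hQ
  have hent : ∀ {F : ℂ → Matrix (Fin n) (Fin n) ℂ}, ContDiff ℝ 1 (fun z => φ (F z)) → ∀ z v a b,
      fderiv ℝ (fun z => F z a b) z v = φ.symm (fderiv ℝ (fun z => φ (F z)) z v) a b :=
    fun {F} hF z v a b => by
    have h1 : HasFDerivAt (fun z => F z a b) ((e a b).comp (fderiv ℝ (fun z => φ (F z)) z)) z := by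
      have := (e a b).hasFDerivAt.comp z ((hF.differentiable (by norm_num)) z).hasFDerivAt
      refine this.congr_of_eventuallyEq (Eventually.of_forall fun y => ?_)
      simp [he]
    rw [h1.fderiv]
    rfl
  let ω : ℂ → ℂ →L[ℝ] 𝔸 := fun z =>
    Complex.reCLM.smulRight (p z) + Complex.imCLM.smulRight (q z)
  have hω : ContDiff ℝ 1 ω :=
    (contDiff_const.smulRight hp1).add (contDiff_const.smulRight hq1)
  have hD : ∀ z v h, fderiv ℝ ω z v h = h.re • fderiv ℝ p z v + h.im • fderiv ℝ q z v := by
    intro z v h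
    have h1 : fderiv ℝ (fun z => ω z h) z v = fderiv ℝ ω z v h := by
      rw [fderiv_clm_apply (hω.differentiable (by norm_num) z) (differentiableAt_const h)]
      simp
    rw [← h1]
    have h2 : HasFDerivAt (fun z => ω z h) (h.re • fderiv ℝ p z + h.im • fderiv ℝ q z) z :=
      (((hp1.differentiable (by norm_num)) z).hasFDerivAt.const_smul h.re).add
        (((hq1.differentiable (by norm_num)) z).hasFDerivAt.const_smul h.im)
    rw [h2.fderiv]
    rfl
  have hlin : ∀ (F : ℂ → 𝔸) (z v : ℂ),
      fderiv ℝ F z v = v.re • fderiv ℝ F z 1 + v.im • fderiv ℝ F z Complex.I := fun F z v => by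
    rw [← map_smul, ← map_smul, ← map_add]
    congr 1
    simp
  obtain ⟨Ψ, hΨ0, hΨ⟩ := exists_flat_frame (ω := ω) hω fun z v h => by
    have hz : fderiv ℝ q z 1 - fderiv ℝ p z Complex.I + (q z * p z - p z * q z) = 0 := by
      apply φ.symm.injective
      ext a b
      have := hflat z a b
      rw [hent hq1, hent hp1] at this
      simpa [hp, hq] using this
    have hq' : fderiv ℝ q z 1 = fderiv ℝ p z Complex.I - (q z * p z - p z * q z) := by
      rw [← sub_eq_zero, ← hz]; abel
    rw [hD, hD, hlin p z v, hlin q z v, hlin p z h, hlin q z h, hq']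
    simp only [ω, _root_.add_apply, ContinuousLinearMap.smulRight_apply, Complex.reCLM_apply,
      Complex.imCLM_apply, add_mul, mul_add, smul_mul_assoc, mul_smul_comm]
    module
  refine ⟨fun z => φ.symm (Ψ z), by simp [hΨ0], fun z a b =>
    ⟨_, (e a b).hasFDerivAt.comp z (hΨ z), fun v => ?_⟩⟩
  simp only [ContinuousLinearMap.comp_apply, he, ContinuousLinearMap.flip_apply,
    ContinuousLinearMap.mul_apply', ω, _root_.add_apply, ContinuousLinearMap.smulRight_apply,
    Complex.reCLM_apply, Complex.imCLM_apply, map_mul, map_add, map_smul, hp, hq,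
    AlgEquiv.symm_apply_apply]
  simp [Matrix.add_mul]

open scoped Matrix.Norms.Frobenius in
/-- `exists_flat_frame` for matrices over the plane, with the connection form `P dx + Q dy`. -/
theorem exists_flat_matrix_frame {n : ℕ} {P Q : ℂ → Matrix (Fin n) (Fin n) ℂ}
    (hP : ∀ a b, ContDiff ℝ 1 fun z => P z a b) (hQ : ∀ a b, ContDiff ℝ 1 fun z => Q z a b)
    (hflat : ∀ z a b, fderiv ℝ (fun z => Q z a b) z 1 - fderiv ℝ (fun z => P z a b) z Complex.I
      + (Q z * P z - P z * Q z) a b = 0) :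
    ∃ Ψ : ℂ → Matrix (Fin n) (Fin n) ℂ, Ψ 0 = 1 ∧ ∀ z a b, ∃ L : ℂ →L[ℝ] ℂ,
      HasFDerivAt (fun z => Ψ z a b) L z ∧
        ∀ v : ℂ, L v = (((v.re : ℂ) • P z + (v.im : ℂ) • Q z) * Ψ z) a b :=
  exists_flat_matrix_frame_of_algEquiv (𝔸 := Matrix (Fin n) (Fin n) ℂ) AlgEquiv.refl hP hQ hflat

/-- A flat frame of a skew-Hermitian connection is unitary. -/
lemma frame_unitary {n : ℕ} {P Q Ψ : ℂ → Matrix (Fin n) (Fin n) ℂ}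
    (hP : ∀ z, (P z)ᴴ = -P z) (hQ : ∀ z, (Q z)ᴴ = -Q z) (hΨ0 : Ψ 0 = 1)
    (hΨ : ∀ z a b, ∃ L : ℂ →L[ℝ] ℂ, HasFDerivAt (fun z => Ψ z a b) L z ∧
      ∀ v : ℂ, L v = (((v.re : ℂ) • P z + (v.im : ℂ) • Q z) * Ψ z) a b) (z : ℂ) :
    Ψ z * (Ψ z)ᴴ = 1 := by
  choose L hL hLv using hΨ
  rw [mul_eq_one_comm]
  ext a b
  have key : ∀ z, HasFDerivAt (fun z => ∑ j, star (Ψ z j a) * Ψ z j b) (0 : ℂ →L[ℝ] ℂ) z := fun z => by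
    have h1 := HasFDerivAt.fun_sum (u := Finset.univ) fun j _ =>
      ((hL z j a).star).mul (hL z j b)
    refine h1.congr_fderiv ?_
    ext1 v
    set W := (v.re : ℂ) • P z + (v.im : ℂ) • Q z with hW
    have hWs : Wᴴ = -W := by
      rw [hW, conjTranspose_add, conjTranspose_smul, conjTranspose_smul, hP, hQ]
      simp
      abel
    have h2 : (W * Ψ z)ᴴ * Ψ z + (Ψ z)ᴴ * (W * Ψ z) = 0 := by
      rw [conjTranspose_mul, hWs, Matrix.mul_assoc, Matrix.neg_mul, Matrix.mul_neg, neg_add_cancel]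
    have h3 := congrFun (congrFun h2 a) b
    simp only [Matrix.add_apply, Matrix.mul_apply (M := (W * Ψ z)ᴴ), Matrix.mul_apply (M := (Ψ z)ᴴ),
      conjTranspose_apply, Matrix.zero_apply, ← Finset.sum_add_distrib] at h3
    rw [_root_.zero_apply, ← h3]
    simp only [_root_.sum_apply]
    refine Finset.sum_congr rfl fun j _ => ?_
    have h5 : ∀ a b, L z a b v = (W * Ψ z) a b := fun a b => hLv z a b v
    simp [h5, mul_comm, add_comm]
  have hconst := is_const_of_fderiv_eq_zero (𝕜 := ℝ) (fun z => (key z).differentiableAt)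
    (fun z => (key z).fderiv) z 0
  have h4 : ∀ z, ((Ψ z)ᴴ * Ψ z) a b = ∑ j, star (Ψ z j a) * Ψ z j b := fun z => by
    simp [Matrix.mul_apply]
  rw [h4, hconst, ← h4, hΨ0]
  simp

end MatrixFrame

/-! ### The Toda connection -/

section TodaConnection

open Matrix

variable {n : ℕ}

/-- The superdiagonal part `S` of the Toda connection, with entries `e^{(t_a - t_{a+1})/2} / √2`. -/
noncomputable def todaOff (t : Fin n → ℂ → ℝ) (z : ℂ) : Matrix (Fin n) (Fin n) ℝ :=
  Matrix.of fun a b => if a.val + 1 = b.val then (√2)⁻¹ * Real.exp ((t a z - t b z) / 2) else 0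

/-- The `dx`-component of the Toda connection. Its diagonal entries are `(i/2) ∂_y t_a`, its other part
is `S - Sᵀ`; it is skew-Hermitian. -/
noncomputable def todaP (t : Fin n → ℂ → ℝ) (z : ℂ) : Matrix (Fin n) (Fin n) ℂ :=
  diagonal (fun a => Complex.I / 2 * (fderiv ℝ (t a) z Complex.I : ℝ)) +
    ((todaOff t z).map Complex.ofReal - ((todaOff t z).map Complex.ofReal)ᵀ)

/-- The `dy`-component of the Toda connection. Its diagonal entries are `-(i/2) ∂_x t_a`, its other part
is `i (S + Sᵀ)`; it is skew-Hermitian. -/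
noncomputable def todaQ (t : Fin n → ℂ → ℝ) (z : ℂ) : Matrix (Fin n) (Fin n) ℂ :=
  diagonal (fun a => -Complex.I / 2 * (fderiv ℝ (t a) z 1 : ℝ)) +
    Complex.I • ((todaOff t z).map Complex.ofReal + ((todaOff t z).map Complex.ofReal)ᵀ)

lemma todaP_apply (t : Fin n → ℂ → ℝ) (z : ℂ) (a b : Fin n) :
    todaP t z a b = (if a = b then Complex.I / 2 * (fderiv ℝ (t a) z Complex.I : ℝ) else 0)
      + ((todaOff t z a b : ℂ) - todaOff t z b a) := by
  simp [todaP, diagonal_apply]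

lemma todaQ_apply (t : Fin n → ℂ → ℝ) (z : ℂ) (a b : Fin n) :
    todaQ t z a b = (if a = b then -Complex.I / 2 * (fderiv ℝ (t a) z 1 : ℝ) else 0)
      + Complex.I * ((todaOff t z a b : ℂ) + todaOff t z b a) := by
  simp [todaQ, diagonal_apply, mul_add]

lemma todaP_conjTranspose (t : Fin n → ℂ → ℝ) (z : ℂ) : (todaP t z)ᴴ = -todaP t z := by
  ext a b
  rw [conjTranspose_apply, Matrix.neg_apply, todaP_apply, todaP_apply]
  rcases eq_or_ne a b with rfl | h
  · simp [Complex.conj_ofReal]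
    ring
  · simp [h, h.symm, Complex.conj_ofReal]

lemma todaQ_conjTranspose (t : Fin n → ℂ → ℝ) (z : ℂ) : (todaQ t z)ᴴ = -todaQ t z := by
  ext a b
  rw [conjTranspose_apply, Matrix.neg_apply, todaQ_apply, todaQ_apply]
  rcases eq_or_ne a b with rfl | h
  · simp [Complex.conj_ofReal]
    ring
  · simp [h, h.symm, Complex.conj_ofReal]
    ring

lemma contDiff_fderiv_apply {f : ℂ → ℝ} (hf : ContDiff ℝ 2 f) (v : ℂ) :
    ContDiff ℝ 1 fun z => fderiv ℝ f z v :=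
  (hf.fderiv_right (m := 1) (by norm_num)).clm_apply contDiff_const

lemma laplacian_eq_fderiv_fderiv {f : ℂ → ℝ} (hf : ContDiff ℝ 2 f) (z : ℂ) :
    (Δ f) z = fderiv ℝ (fun z => fderiv ℝ f z 1) z 1
      + fderiv ℝ (fun z => fderiv ℝ f z Complex.I) z Complex.I := by
  have h : ∀ v w, fderiv ℝ (fun z => fderiv ℝ f z v) z w = fderiv ℝ (fderiv ℝ f) z w v := fun v w => by
    rw [fderiv_clm_apply ((hf.fderiv_right (m := 1) (by norm_num)).differentiable (by norm_num) z)
      (differentiableAt_const v)]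
    simp
  rw [InnerProductSpace.laplacian_eq_iteratedFDeriv_complexPlane, h, h]
  simp [iteratedFDeriv_two_apply]

lemma contDiff_todaOff {t : Fin n → ℂ → ℝ} (ht : ∀ a, ContDiff ℝ 2 (t a)) (a b : Fin n) :
    ContDiff ℝ 1 fun z => todaOff t z a b := by
  by_cases h : a.val + 1 = b.val
  · simp only [todaOff, of_apply, h, if_true]
    exact contDiff_const.mul (Real.contDiff_exp.comp
      ((((ht a).of_le (by norm_num)).sub ((ht b).of_le (by norm_num))).div_const 2))
  · simp only [todaOff, of_apply, h, if_false]
    exact contDiff_const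

lemma hasFDerivAt_todaOff {t : Fin n → ℂ → ℝ} (ht : ∀ a, ContDiff ℝ 2 (t a)) (a b : Fin n) (z : ℂ) :
    HasFDerivAt (fun z => todaOff t z a b)
      ((todaOff t z a b / 2) • (fderiv ℝ (t a) z - fderiv ℝ (t b) z)) z := by
  by_cases h : a.val + 1 = b.val
  · simp only [todaOff, of_apply, h, if_true]
    have hd : ∀ a, HasFDerivAt (t a) (fderiv ℝ (t a) z) z := fun a =>
      ((ht a).differentiable (by norm_num) z).hasFDerivAt
    have h1 := ((((hd a).sub (hd b)).const_mul (2⁻¹ : ℝ)).exp).const_mul (√2)⁻¹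
    refine (h1.congr_of_eventuallyEq (Eventually.of_forall fun y => ?_)).congr_fderiv ?_
    · simp only [Pi.sub_apply]; congr 2; ring
    · rw [smul_smul, smul_smul]; congr 1; simp only [Pi.sub_apply]
      rw [show (2⁻¹ : ℝ) * (t a z - t b z) = (t a z - t b z) / 2 by ring]; ring
  · simp only [todaOff, of_apply, h, if_false]
    simpa using hasFDerivAt_const (0 : ℝ) z

lemma contDiff_todaP {t : Fin n → ℂ → ℝ} (ht : ∀ a, ContDiff ℝ 2 (t a)) (a b : Fin n) :
    ContDiff ℝ 1 fun z => todaP t z a b := by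
  simp only [todaP_apply]
  have h1 : ∀ a b, ContDiff ℝ 1 fun z => (todaOff t z a b : ℂ) := fun a b =>
    Complex.ofRealCLM.contDiff.comp (contDiff_todaOff ht a b)
  refine ContDiff.add ?_ ((h1 a b).sub (h1 b a))
  split_ifs
  · exact contDiff_const.mul (Complex.ofRealCLM.contDiff.comp (contDiff_fderiv_apply (ht a) _))
  · exact contDiff_const

lemma contDiff_todaQ {t : Fin n → ℂ → ℝ} (ht : ∀ a, ContDiff ℝ 2 (t a)) (a b : Fin n) :
    ContDiff ℝ 1 fun z => todaQ t z a b := by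
  simp only [todaQ_apply]
  have h1 : ∀ a b, ContDiff ℝ 1 fun z => (todaOff t z a b : ℂ) := fun a b =>
    Complex.ofRealCLM.contDiff.comp (contDiff_todaOff ht a b)
  refine ContDiff.add ?_ (contDiff_const.mul ((h1 a b).add (h1 b a)))
  split_ifs
  · exact contDiff_const.mul (Complex.ofRealCLM.contDiff.comp (contDiff_fderiv_apply (ht a) _))
  · exact contDiff_const

lemma hasFDerivAt_ite_mul_ofReal {p : Prop} [Decidable p] {f : ℂ → ℝ} {z : ℂ} (hf : DifferentiableAt ℝ f z)
    (c : ℂ) : HasFDerivAt (fun z => if p then c * (f z : ℂ) else 0)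
      (if p then c • Complex.ofRealCLM.comp (fderiv ℝ f z) else 0) z := by
  split_ifs
  · exact (Complex.ofRealCLM.hasFDerivAt.comp z hf.hasFDerivAt).const_mul c
  · exact hasFDerivAt_const 0 z

lemma commutator_skew_add (p q S T : Matrix (Fin n) (Fin n) ℂ) :
    (q + Complex.I • (S + T)) * (p + (S - T)) - (p + (S - T)) * (q + Complex.I • (S + T)) =
      (q * p - p * q) + (q * (S - T) - (S - T) * q) + Complex.I • ((S + T) * p - p * (S + T))
        + (2 * Complex.I) • (T * S - S * T) := by
  simp only [add_mul, mul_add, mul_sub, sub_mul, smul_mul_assoc, mul_smul_comm, smul_add, smul_sub]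
  module

lemma todaOff_transpose_mul (t : Fin n → ℂ → ℝ) (z : ℂ) :
    (todaOff t z)ᵀ * todaOff t z = diagonal fun a => ∑ j, todaOff t z j a ^ 2 := by
  ext a b
  rw [mul_apply, diagonal_apply]
  split_ifs with h
  · subst h; simp [sq]
  · refine Finset.sum_eq_zero fun j _ => ?_
    simp only [transpose_apply, todaOff, of_apply]
    have : ¬ (j.val + 1 = a.val ∧ j.val + 1 = b.val) := fun h' => h (Fin.ext (h'.1.symm.trans h'.2))
    split_ifs <;> simp_all

lemma todaOff_mul_transpose (t : Fin n → ℂ → ℝ) (z : ℂ) :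
    todaOff t z * (todaOff t z)ᵀ = diagonal fun a => ∑ j, todaOff t z a j ^ 2 := by
  ext a b
  rw [mul_apply, diagonal_apply]
  split_ifs with h
  · subst h; simp [sq]
  · refine Finset.sum_eq_zero fun j _ => ?_
    simp only [transpose_apply, todaOff, of_apply]
    have : ¬ (a.val + 1 = j.val ∧ b.val + 1 = j.val) := fun h' => h (Fin.ext (by omega))
    split_ifs <;> simp_all

/-- The Toda equations say that the Toda connection is flat. -/
lemma todaConnection_flat {t : Fin n → ℂ → ℝ} (ht : ∀ a, ContDiff ℝ 2 (t a))
    (hT : ∀ a z, (Δ (t a)) z = 4 * (∑ j, todaOff t z j a ^ 2 - ∑ j, todaOff t z a j ^ 2))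
    (z : ℂ) (a b : Fin n) :
    fderiv ℝ (fun z => todaQ t z a b) z 1 - fderiv ℝ (fun z => todaP t z a b) z Complex.I
      + (todaQ t z * todaP t z - todaP t z * todaQ t z) a b = 0 := by
  have hS : ∀ a b, HasFDerivAt (fun z => (todaOff t z a b : ℂ)) (Complex.ofRealCLM.comp
      ((todaOff t z a b / 2) • (fderiv ℝ (t a) z - fderiv ℝ (t b) z))) z := fun a b =>
    Complex.ofRealCLM.hasFDerivAt.comp z (hasFDerivAt_todaOff ht a b z)
  have hd : ∀ v, DifferentiableAt ℝ (fun z => fderiv ℝ (t a) z v) z := fun v =>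
    (contDiff_fderiv_apply (ht a) v).differentiable (by norm_num) z
  have hQ := (hasFDerivAt_ite_mul_ofReal (p := a = b) (hd 1) (-Complex.I / 2)).add (((hS a b).add (hS b a)).const_mul Complex.I)
  have hP := (hasFDerivAt_ite_mul_ofReal (p := a = b) (hd Complex.I) (Complex.I / 2)).add ((hS a b).sub (hS b a))
  have hTS : ((todaOff t z).map Complex.ofReal)ᵀ * (todaOff t z).map Complex.ofReal =
      ((todaOff t z)ᵀ * todaOff t z).map Complex.ofReal := by
    rw [← transpose_map]
    exact (Matrix.map_mul (f := Complex.ofRealHom)).symm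
  have hST : (todaOff t z).map Complex.ofReal * ((todaOff t z).map Complex.ofReal)ᵀ =
      (todaOff t z * (todaOff t z)ᵀ).map Complex.ofReal := by
    rw [← transpose_map]
    exact (Matrix.map_mul (f := Complex.ofRealHom)).symm
  have hQ' := hQ.congr_of_eventuallyEq (f₁ := fun z => todaQ t z a b)
    (Eventually.of_forall fun y => todaQ_apply t y a b)
  have hP' := hP.congr_of_eventuallyEq (f₁ := fun z => todaP t z a b)
    (Eventually.of_forall fun y => todaP_apply t y a b)
  rw [hQ'.fderiv, hP'.fderiv, todaQ, todaP, commutator_skew_add, hTS, hST, todaOff_transpose_mul,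
    todaOff_mul_transpose]
  have hL := hT a z
  rw [laplacian_eq_fderiv_fderiv (ht a)] at hL
  have hL' : (fderiv ℝ (fun z => fderiv ℝ (t a) z 1) z 1 : ℂ) = 4 * (∑ j, (todaOff t z j a : ℂ) ^ 2
      - ∑ j, (todaOff t z a j : ℂ) ^ 2)
      - fderiv ℝ (fun z => fderiv ℝ (t a) z Complex.I) z Complex.I := by
    rw [eq_sub_iff_add_eq]; exact_mod_cast hL
  by_cases hab : a = b
  · subst hab
    simp [hL', diagonal_mul, mul_diagonal]
    ring
  · simp [hab, diagonal_mul, mul_diagonal]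
    linear_combination (-(1 / 2) * ((todaOff t z a b : ℂ) + todaOff t z b a) *
      ((fderiv ℝ (t a) z Complex.I : ℂ) - fderiv ℝ (t b) z Complex.I)) * Complex.I_sq

/-- The `(0,1)`-part of the Toda connection, up to a constant factor: the superdiagonal part `S` drops
out, and only the diagonal and `Sᵀ` remain. -/
lemma todaQ_sub_I_mul_todaP (t : Fin n → ℂ → ℝ) (z : ℂ) (a b : Fin n) :
    todaQ t z a b - Complex.I * todaP t z a b =
      (if a = b then ((fderiv ℝ (t a) z Complex.I : ℝ) - Complex.I * (fderiv ℝ (t a) z 1 : ℝ)) / 2 else 0)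
        + 2 * Complex.I * todaOff t z b a := by
  rw [todaP_apply, todaQ_apply]
  split_ifs
  · linear_combination (-(fderiv ℝ (t a) z Complex.I : ℂ) / 2) * Complex.I_sq
  · ring

/-- The minors of the first `k` rows of a unitary flat frame of the Toda connection, multiplied by
`exp (-(t_0 + ⋯ + t_{k-1}) / 2)`, are entire functions. The `∂̄`-derivative of a row of the frame is a
multiple of the row plus a multiple of the preceding row, so the `∂̄`-derivative of the minor is a
multiple of the minor, and the exponential factor cancels it. By the Cauchy–Binet formula the squared
absolute values of these entire functions add up to a multiple of `exp (-(t_0 + ⋯ + t_{k-1}))`. -/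
theorem exists_entire_sum_norm_sq {t : Fin n → ℂ → ℝ} (ht : ∀ a, ContDiff ℝ 2 (t a))
    (hT : ∀ a z, (Δ (t a)) z = 4 * (∑ j, todaOff t z j a ^ 2 - ∑ j, todaOff t z a j ^ 2))
    {k : ℕ} (hk : k ≤ n) :
    ∃ D : (Fin k → Fin n) → ℂ → ℂ, (∀ p, Differentiable ℂ (D p)) ∧ ∀ z,
      ∑ p, ‖D p z‖ ^ 2 = k.factorial * Real.exp (-∑ a : Fin k, t (Fin.castLE hk a) z) := by
  obtain ⟨Ψ, hΨ0, hΨ⟩ := exists_flat_matrix_frame (contDiff_todaP ht) (contDiff_todaQ ht)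
    (todaConnection_flat ht hT)
  have hU := frame_unitary (todaP_conjTranspose t) (todaQ_conjTranspose t) hΨ0 hΨ
  choose L hL hLv using hΨ
  let w : ℂ → ℝ := fun z => ∑ a : Fin k, t (Fin.castLE hk a) z
  let M : (Fin k → Fin n) → ℂ → Matrix (Fin k) (Fin k) ℂ := fun p z =>
    Matrix.of fun a b => Ψ z (Fin.castLE hk a) (p b)
  refine ⟨fun p z => (Real.exp (-(1 / 2) * w z) : ℂ) * det (M p z), fun p z => ?_, fun z => ?_⟩
  · obtain ⟨L', hL', hL'v⟩ := hasFDerivAt_det (M := M p)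
      (M' := fun a b => L z (Fin.castLE hk a) (p b)) (fun a b => hL z _ _)
    have hw : HasFDerivAt w (∑ a : Fin k, fderiv ℝ (t (Fin.castLE hk a)) z) z :=
      HasFDerivAt.fun_sum fun a _ => ((ht _).differentiable (by norm_num) z).hasFDerivAt
    have hg := Complex.ofRealCLM.hasFDerivAt.comp z (hw.const_mul (-(1 / 2) : ℝ)).exp
    have hD := hg.mul hL'
    have hrow : ∀ a : Fin k, (fun b => L z (Fin.castLE hk a) (p b) Complex.I
        - Complex.I * L z (Fin.castLE hk a) (p b) 1) =
        (((fderiv ℝ (t (Fin.castLE hk a)) z Complex.I : ℝ)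
          - Complex.I * (fderiv ℝ (t (Fin.castLE hk a)) z 1 : ℝ)) / 2 : ℂ) • M p z a +
        fun b => ∑ j, 2 * Complex.I * todaOff t z j (Fin.castLE hk a) * Ψ z j (p b) := fun a => by
      ext1 b
      rw [hLv, hLv]
      simp only [Complex.I_re, Complex.I_im, Complex.one_re, Complex.one_im, Complex.ofReal_zero,
        Complex.ofReal_one, zero_smul, one_smul, zero_add, add_zero, Matrix.mul_apply, Pi.add_apply,
        Pi.smul_apply, smul_eq_mul, Finset.mul_sum, ← Finset.sum_sub_distrib]
      have : ∀ j, todaQ t z (Fin.castLE hk a) j * Ψ z j (p b)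
          - Complex.I * (todaP t z (Fin.castLE hk a) j * Ψ z j (p b)) =
          (todaQ t z (Fin.castLE hk a) j - Complex.I * todaP t z (Fin.castLE hk a) j) * Ψ z j (p b) :=
        fun j => by ring
      simp only [this, todaQ_sub_I_mul_todaP, add_mul, Finset.sum_add_distrib, ite_mul, zero_mul,
        Finset.sum_ite_eq, Finset.mem_univ, if_true]
      rfl
    have hzero : ∀ a : Fin k, det (Matrix.updateRow (M p z) a
        (fun b => ∑ j, 2 * Complex.I * todaOff t z j (Fin.castLE hk a) * Ψ z j (p b))) = 0 := fun a => by
      by_cases ha : a.val = 0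
      · refine det_eq_zero_of_row_eq_zero a fun b => ?_
        rw [updateRow_self]
        refine Finset.sum_eq_zero fun j _ => ?_
        simp [todaOff, ha]
      · let a' : Fin k := ⟨a.val - 1, by omega⟩
        have haa : a' ≠ a := fun h => by
          have := congrArg Fin.val h
          simp only [a'] at this
          omega
        have : (fun b => ∑ j, 2 * Complex.I * todaOff t z j (Fin.castLE hk a) * Ψ z j (p b)) =
            (2 * Complex.I * todaOff t z (Fin.castLE hk a') (Fin.castLE hk a)) • M p z a' := by
          ext1 b
          rw [Finset.sum_eq_single (Fin.castLE hk a')]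
          · rfl
          · intro j _ hj
            have : ¬ (j.val + 1 = (Fin.castLE hk a).val) := fun h => hj (Fin.ext (by
              simp only [Fin.val_castLE, a'] at h ⊢; omega))
            simp only [todaOff, of_apply, this, if_false]
            simp
          · simp
        rw [this, det_updateRow_smul]
        have h0 : det (Matrix.updateRow (M p z) a (M p z a')) = 0 := det_updateRow_eq_zero haa
        rw [h0, mul_zero]
    have hLI : L' Complex.I - Complex.I * L' 1 =
        (∑ a : Fin k, ((fderiv ℝ (t (Fin.castLE hk a)) z Complex.I : ℝ)
          - Complex.I * (fderiv ℝ (t (Fin.castLE hk a)) z 1 : ℝ)) / 2 : ℂ) * det (M p z) := by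
      rw [hL'v, hL'v, Finset.mul_sum, ← Finset.sum_sub_distrib, Finset.sum_mul]
      refine Finset.sum_congr rfl fun a _ => ?_
      have h1 : det (Matrix.updateRow (M p z) a fun b => L z (Fin.castLE hk a) (p b) Complex.I) =
          det (Matrix.updateRow (M p z) a (fun b => L z (Fin.castLE hk a) (p b) Complex.I
            - Complex.I * L z (Fin.castLE hk a) (p b) 1))
          + Complex.I * det (Matrix.updateRow (M p z) a fun b => L z (Fin.castLE hk a) (p b) 1) := by
        rw [← det_updateRow_smul, ← det_updateRow_add]
        congr 2
        ext1 b
        simp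
      rw [h1, add_sub_cancel_right, hrow, det_updateRow_add, hzero, add_zero, det_updateRow_smul]
      congr 2
      exact updateRow_eq_self _ _
    refine differentiableAt_complex_iff_differentiableAt_real.2 ⟨hD.differentiableAt, ?_⟩
    refine Eq.trans (congrArg (fun l : ℂ →L[ℝ] ℂ => l Complex.I) hD.fderiv) ?_
    refine Eq.trans ?_ (congrArg (fun l : ℂ →L[ℝ] ℂ => Complex.I • l 1) hD.fderiv).symm
    have hsum : (∑ a : Fin k, ((fderiv ℝ (t (Fin.castLE hk a)) z Complex.I : ℝ)
          - Complex.I * (fderiv ℝ (t (Fin.castLE hk a)) z 1 : ℝ)) / 2 : ℂ) =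
        ((∑ a : Fin k, fderiv ℝ (t (Fin.castLE hk a)) z Complex.I : ℝ)
          - Complex.I * (∑ a : Fin k, fderiv ℝ (t (Fin.castLE hk a)) z 1 : ℝ)) / 2 := by
      push_cast
      rw [← Finset.sum_div, Finset.sum_sub_distrib, Finset.mul_sum]
    rw [hsum] at hLI
    have hLI' := eq_add_of_sub_eq hLI
    simp only [_root_.add_apply, _root_.smul_apply, smul_eq_mul, hLI', ContinuousLinearMap.comp_apply,
      Complex.ofRealCLM_apply, _root_.sum_apply, Function.comp_apply, Complex.ofReal_mul,
      Complex.ofReal_neg, Complex.ofReal_div, Complex.ofReal_one, Complex.ofReal_ofNat]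
    ring
  · have hA : (Ψ z).submatrix (Fin.castLE hk) id * ((Ψ z).submatrix (Fin.castLE hk) id)ᴴ = 1 := by
      rw [conjTranspose_submatrix, ← submatrix_mul _ _ _ _ _ Function.bijective_id, hU,
        submatrix_one _ (Fin.castLE_injective hk)]
    have h := sum_norm_sq_det_submatrix hA
    rw [Fintype.card_fin] at h
    rw [← h, Finset.sum_mul]
    refine Finset.sum_congr rfl fun p _ => ?_
    rw [norm_mul, mul_pow, mul_comm]
    congr 1
    rw [Complex.norm_real, Real.norm_of_nonneg (Real.exp_pos _).le, ← Real.exp_nat_mul]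
    congr 1
    push_cast
    ring

end TodaConnection

/-! ### Averages over discs -/

section RadialAverages

/-- The radial weight `(1 - |z|²)₊`. -/
noncomputable def radialWeight (z : ℂ) : ℝ := max (1 - ‖z‖ ^ 2) 0

lemma continuous_radialWeight : Continuous radialWeight := by unfold radialWeight; fun_prop

lemma radialWeight_nonneg (z : ℂ) : 0 ≤ radialWeight z := le_max_right _ _

lemma radialWeight_le_one (z : ℂ) : radialWeight z ≤ 1 :=
  max_le (by nlinarith [sq_nonneg ‖z‖]) zero_le_one

lemma radialWeight_eq_zero {z : ℂ} (hz : 1 ≤ ‖z‖) : radialWeight z = 0 :=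
  max_eq_right (by nlinarith)

lemma hasCompactSupport_radialWeight : HasCompactSupport radialWeight :=
  HasCompactSupport.intro (isCompact_closedBall (0 : ℂ) 1) fun z hz =>
    radialWeight_eq_zero (by simpa using (not_le.1 fun h => hz (by simpa using h)).le)

lemma integrable_radialWeight : Integrable radialWeight :=
  continuous_radialWeight.integrable_of_hasCompactSupport hasCompactSupport_radialWeight

lemma Continuous.integrable_mul_radialWeight {f : ℂ → ℝ} (hf : Continuous f) :
    Integrable fun z => f z * radialWeight z :=
  (hf.mul continuous_radialWeight).integrable_of_hasCompactSupport
    hasCompactSupport_radialWeight.mul_left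

lemma integral_radialWeight : ∫ z, radialWeight z = Real.pi / 2 := by
  have h := integral_fun_norm_addHaar (E := ℂ) volume fun r : ℝ => max (1 - r ^ 2) 0
  have h2 : ∫ y in Ioi (0 : ℝ), y ^ (2 - 1) • max (1 - y ^ 2) 0 = 1 / 4 := by
    have h3 : ∫ y in Ioi (0 : ℝ), y ^ (2 - 1) • max (1 - y ^ 2) 0 =
        ∫ y in Ioc (0 : ℝ) 1, y * (1 - y ^ 2) := by
      rw [setIntegral_eq_of_subset_of_forall_sdiff_eq_zero measurableSet_Ioi
        (Ioc_subset_Ioi_self : Ioc (0 : ℝ) 1 ⊆ Ioi 0)]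
      · refine setIntegral_congr_fun measurableSet_Ioc fun y hy => ?_
        have : y ^ 2 ≤ 1 := pow_le_one₀ hy.1.le hy.2
        simp [this]
      · rintro y ⟨hy0, hy1⟩
        have h1 : 1 < y := not_le.1 fun h => hy1 ⟨hy0, h⟩
        have : 1 ≤ y ^ 2 := one_le_pow₀ h1.le
        simp [this]
    rw [h3, ← intervalIntegral.integral_of_le zero_le_one]
    have h4 : ∀ x ∈ uIcc (0 : ℝ) 1, HasDerivAt (fun x : ℝ => x ^ 2 / 2 - x ^ 4 / 4) (x * (1 - x ^ 2)) x :=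
      fun x _ => by
        refine (((hasDerivAt_pow 2 x).div_const 2).sub ((hasDerivAt_pow 4 x).div_const 4)).congr_deriv ?_
        push_cast; ring
    rw [intervalIntegral.integral_eq_sub_of_hasDerivAt h4 (Continuous.intervalIntegrable (by fun_prop) _ _)]
    norm_num
  rw [Complex.finrank_real_complex, h2] at h
  change ∫ z, radialWeight z = _ at h
  rw [h]
  simp [Measure.real, Complex.volume_ball]
  ring

/-- The potential `(1 - |z|²)₊² / 4` of the radial weight: its gradient is `-radialWeight z • z`. -/
noncomputable def radialPotential (z : ℂ) : ℝ := radialWeight z ^ 2 / 4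

lemma hasDerivAt_max_zero_sq (x : ℝ) : HasDerivAt (fun x : ℝ => max x 0 ^ 2) (2 * max x 0) x := by
  rcases lt_trichotomy x 0 with h | rfl | h
  · refine ((hasDerivAt_const x (0 : ℝ)).congr_of_eventuallyEq ?_).congr_deriv (by simp [h.le])
    filter_upwards [Iio_mem_nhds h] with y hy
    simp [(mem_Iio.1 hy).le]
  · rw [hasDerivAt_iff_isLittleO_nhds_zero]
    refine Asymptotics.IsBigO.trans_isLittleO (g := fun h : ℝ => h ^ 2) ?_ ?_
    · refine Asymptotics.IsBigO.of_bound 1 (Eventually.of_forall fun y => ?_)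
      rcases le_total y 0 with hy | hy <;> simp [hy, sq_nonneg]
    · simpa using Asymptotics.isLittleO_pow_pow (𝕜 := ℝ) (m := 1) (n := 2) (by norm_num)
  · refine ((hasDerivAt_pow 2 x).congr_of_eventuallyEq ?_).congr_deriv (by simp [h.le])
    filter_upwards [Ioi_mem_nhds h] with y hy
    simp [(mem_Ioi.1 hy).le]

lemma hasFDerivAt_radialPotential (z : ℂ) :
    HasFDerivAt radialPotential (-radialWeight z • innerSL ℝ z) z := by
  have h1 : HasFDerivAt (fun z : ℂ => 1 - ‖z‖ ^ 2) (-(2 • innerSL ℝ z)) z :=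
    ((hasStrictFDerivAt_norm_sq z).hasFDerivAt).const_sub 1
  have h2 := ((hasDerivAt_max_zero_sq (1 - ‖z‖ ^ 2)).comp_hasFDerivAt z h1).mul_const (4⁻¹ : ℝ)
  refine (h2.congr_of_eventuallyEq (Eventually.of_forall fun y => ?_)).congr_fderiv ?_
  · simp [radialPotential, radialWeight, div_eq_mul_inv]
  · ext v
    simp [radialWeight]
    ring

lemma fderiv_radialPotential (z v : ℂ) :
    fderiv ℝ radialPotential z v = -radialWeight z * (z.re * v.re + z.im * v.im) := by
  rw [(hasFDerivAt_radialPotential z).fderiv]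
  simp [Complex.inner]
  ring_nf
  simp

lemma continuous_radialPotential : Continuous radialPotential :=
  (continuous_radialWeight.pow 2).div_const 4

lemma hasCompactSupport_radialPotential : HasCompactSupport radialPotential :=
  hasCompactSupport_radialWeight.comp_left (g := fun x => x ^ 2 / 4) (by simp)

lemma radialPotential_nonneg (z : ℂ) : 0 ≤ radialPotential z := by
  unfold radialPotential; positivity

lemma radialPotential_le (z : ℂ) : radialPotential z ≤ 1 / 4 := by
  unfold radialPotential
  have := pow_le_one₀ (n := 2) (radialWeight_nonneg z) (radialWeight_le_one z)
  linarith

lemma radialPotential_zero : radialPotential 0 = 1 / 4 := by simp [radialPotential, radialWeight]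

lemma Continuous.integrable_mul_radialPotential {f : ℂ → ℝ} (hf : Continuous f) :
    Integrable fun z => f z * radialPotential z :=
  (hf.mul continuous_radialPotential).integrable_of_hasCompactSupport
    hasCompactSupport_radialPotential.mul_left

/-- The average of `u` over the disc of radius `e^s`, with respect to the rescaled radial weight, whose
total mass is `π / 2`. -/
noncomputable def radialMean (u : ℂ → ℝ) (s : ℝ) : ℝ := ∫ y, u (Real.exp s • y) * radialWeight y

lemma Continuous.integrable_comp_exp_smul_mul_radialWeight {u : ℂ → ℝ} (hu : Continuous u) (s : ℝ) :
    Integrable fun y => u (Real.exp s • y) * radialWeight y :=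
  Continuous.integrable_mul_radialWeight (f := fun y => u (Real.exp s • y)) (hu.comp (by fun_prop))

lemma continuous_laplacian {u : ℂ → ℝ} (hu : ContDiff ℝ 2 u) : Continuous (Δ u) := by
  have : Δ u = fun z => fderiv ℝ (fun z => fderiv ℝ u z 1) z 1
      + fderiv ℝ (fun z => fderiv ℝ u z Complex.I) z Complex.I :=
    funext fun z => laplacian_eq_fderiv_fderiv hu z
  rw [this]
  exact (((contDiff_fderiv_apply hu _).continuous_fderiv (by norm_num)).clm_apply continuous_const).add
    (((contDiff_fderiv_apply hu _).continuous_fderiv (by norm_num)).clm_apply continuous_const)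

/-- Green's formula on the disc of radius `R`. -/
lemma integral_fderiv_smul_mul_radialWeight {u : ℂ → ℝ} (hu : ContDiff ℝ 2 u) (R : ℝ) :
    ∫ y, fderiv ℝ u (R • y) (R • y) * radialWeight y =
      R ^ 2 * ∫ y, (Δ u) (R • y) * radialPotential y := by
  have hpart : ∀ e : ℂ, ∫ y, fderiv ℝ u (R • y) e * fderiv ℝ radialPotential y e =
      -∫ y, R * fderiv ℝ (fun z => fderiv ℝ u z e) (R • y) e * radialPotential y := fun e => by
    have hg1 := contDiff_fderiv_apply hu e
    have hg : ContDiff ℝ 1 fun y : ℂ => fderiv ℝ u (R • y) e :=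
      hg1.comp (contDiff_id.const_smul R)
    have hd : ∀ y, fderiv ℝ (fun y : ℂ => fderiv ℝ u (R • y) e) y e =
        R * fderiv ℝ (fun z => fderiv ℝ u z e) (R • y) e := fun y => by
      have h1 : HasFDerivAt (fun y : ℂ => R • y) (R • ContinuousLinearMap.id ℝ ℂ) y :=
        (hasFDerivAt_id y).const_smul R
      have h2 := ((hg1.differentiable (by norm_num) (R • y)).hasFDerivAt).comp y h1
      have h3 : fderiv ℝ (fun y : ℂ => fderiv ℝ u (R • y) e) y = _ := h2.fderiv
      rw [h3]
      simp
    have hcont : Continuous fun y => fderiv ℝ radialPotential y e := by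
      simp only [fderiv_radialPotential]
      exact continuous_radialWeight.neg.mul (by fun_prop)
    have h := integral_mul_fderiv_eq_neg_fderiv_mul_of_integrable (μ := volume) (v := e)
      (f := fun y : ℂ => fderiv ℝ u (R • y) e) (g := radialPotential)
      (((hg.continuous_fderiv (by norm_num)).clm_apply continuous_const).integrable_mul_radialPotential)
      ((hg.continuous.mul hcont).integrable_of_hasCompactSupport
        (HasCompactSupport.mul_left (hasCompactSupport_radialPotential.fderiv_apply ℝ e)))
      hg.continuous.integrable_mul_radialPotential
      (fun y _ => hg.differentiable (by norm_num) y)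
      (fun y _ => (hasFDerivAt_radialPotential y).differentiableAt)
    rw [h]
    simp only [hd]
  have hcont : ∀ e, Continuous fun y : ℂ => R * fderiv ℝ (fun z => fderiv ℝ u z e) (R • y) e :=
    fun e => continuous_const.mul ((((contDiff_fderiv_apply hu e).continuous_fderiv
      (by norm_num)).comp (by fun_prop)).clm_apply continuous_const)
  have hcont' : ∀ e, Integrable fun y => fderiv ℝ u (R • y) e * fderiv ℝ radialPotential y e :=
    fun e => by
    have hc1 : Continuous fun y : ℂ => fderiv ℝ u (R • y) e :=
      (contDiff_fderiv_apply hu e).continuous.comp (by fun_prop)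
    have hc2 : Continuous fun y : ℂ => -(y.re * e.re + y.im * e.im) := by fun_prop
    refine ((hc1.mul hc2).integrable_mul_radialWeight).congr (Eventually.of_forall fun y => ?_)
    simp only [fderiv_radialPotential, Pi.mul_apply]
    ring
  have hgrad : ∀ y, fderiv ℝ u (R • y) (R • y) * radialWeight y =
      -R * (fderiv ℝ u (R • y) 1 * fderiv ℝ radialPotential y 1
        + fderiv ℝ u (R • y) Complex.I * fderiv ℝ radialPotential y Complex.I) := fun y => by
    have hy : R • y = (R * y.re) • (1 : ℂ) + (R * y.im) • Complex.I := by
      apply Complex.ext <;> simp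
    have : fderiv ℝ u (R • y) (R • y) = R * y.re * fderiv ℝ u (R • y) 1
        + R * y.im * fderiv ℝ u (R • y) Complex.I := by
      conv_lhs => rw [show fderiv ℝ u (R • y) (R • y) = fderiv ℝ u (R • y)
        ((R * y.re) • (1 : ℂ) + (R * y.im) • Complex.I) by rw [← hy]]
      rw [map_add, map_smul, map_smul, smul_eq_mul, smul_eq_mul]
    rw [this, fderiv_radialPotential, fderiv_radialPotential]
    simp
    ring
  simp only [hgrad]
  rw [integral_const_mul, integral_add (hcont' _) (hcont' _), hpart, hpart, ← neg_add,
    ← integral_add (hcont _).integrable_mul_radialPotential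
      (hcont _).integrable_mul_radialPotential, neg_mul_neg, ← integral_const_mul,
    ← integral_const_mul]
  refine integral_congr_ae (Eventually.of_forall fun y => ?_)
  simp only [laplacian_eq_fderiv_fderiv hu]
  ring

lemma integral_exp_smul (f : ℂ → ℝ) (s : ℝ) :
    ∫ y, f (Real.exp s • y) = Real.exp (-(2 * s)) * ∫ y, f y := by
  rw [Measure.integral_comp_smul, Complex.finrank_real_complex, smul_eq_mul, ← Real.exp_nat_mul,
    ← Real.exp_neg, abs_of_pos (Real.exp_pos _)]
  norm_num

/-- The derivative of the averages with respect to the logarithm `s` of the radius. -/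
lemma hasDerivAt_radialMean {u : ℂ → ℝ} (hu : ContDiff ℝ 2 u) (s : ℝ) :
    HasDerivAt (radialMean u) (∫ y, (Δ u) y * radialPotential (Real.exp (-s) • y)) s := by
  have hd := hu.differentiable (by norm_num)
  have hDc := hu.continuous_fderiv (by norm_num)
  have hcont : Continuous fun q : ℝ × ℂ => fderiv ℝ u (Real.exp q.1 • q.2) (Real.exp q.1 • q.2) :=
    (hDc.comp (by fun_prop)).clm_apply (by fun_prop)
  obtain ⟨C, hC⟩ := ((isCompact_closedBall s 1).prod (isCompact_closedBall (0 : ℂ) 1)).exists_bound_of_continuousOn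
    hcont.continuousOn
  have hderiv : ∀ y : ℂ, ∀ x : ℝ, HasDerivAt (fun x => u (Real.exp x • y) * radialWeight y)
      (fderiv ℝ u (Real.exp x • y) (Real.exp x • y) * radialWeight y) x := fun y x => by
    have h1 : HasDerivAt (fun x : ℝ => Real.exp x • y) (Real.exp x • y) x :=
      (Real.hasDerivAt_exp x).smul_const y
    exact ((hd _).hasFDerivAt.comp_hasDerivAt x h1).mul_const _
  have h := (hasDerivAt_integral_of_dominated_loc_of_deriv_le (μ := volume)
    (F := fun x y => u (Real.exp x • y) * radialWeight y)
    (F' := fun x y => fderiv ℝ u (Real.exp x • y) (Real.exp x • y) * radialWeight y)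
    (bound := fun y => C * radialWeight y) (Metric.ball_mem_nhds s one_pos)
    (Eventually.of_forall fun x => (hu.continuous.integrable_comp_exp_smul_mul_radialWeight x).aestronglyMeasurable)
    (hu.continuous.integrable_comp_exp_smul_mul_radialWeight s)
    (((hDc.comp (by fun_prop)).clm_apply (by fun_prop)).integrable_mul_radialWeight).aestronglyMeasurable
    (Eventually.of_forall fun y x hx => ?_) (integrable_radialWeight.const_mul C)
    (Eventually.of_forall fun y x _ => hderiv y x)).2
  · refine h.congr_deriv ?_
    have h2 := integral_exp_smul (fun y => (Δ u) y * radialPotential (Real.exp (-s) • y)) s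
    simp only [smul_smul, ← Real.exp_add, neg_add_cancel, Real.exp_zero, one_smul] at h2
    rw [integral_fderiv_smul_mul_radialWeight hu, h2, ← Real.exp_nat_mul, ← mul_assoc, ← Real.exp_add]
    simp
  · rw [norm_mul, Real.norm_of_nonneg (radialWeight_nonneg y)]
    rcases le_total ‖y‖ 1 with hy | hy
    · exact mul_le_mul_of_nonneg_right (hC (x, y) ⟨Metric.ball_subset_closedBall hx, by simpa using hy⟩)
        (radialWeight_nonneg y)
    · simp [radialWeight_eq_zero hy]

end RadialAverages

/-! ### Growth of averages -/

section MeanGrowth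

lemma integral_laplacian_mul_le {u : ℂ → ℝ} (hL : Integrable (Δ u)) (s : ℝ) :
    |∫ y, (Δ u) y * radialPotential (Real.exp (-s) • y)| ≤ ∫ y, |(Δ u) y| := by
  rw [← Real.norm_eq_abs]
  refine norm_integral_le_of_norm_le hL.abs (Eventually.of_forall fun y => ?_)
  simp only [norm_mul, Real.norm_eq_abs]
  rw [abs_of_nonneg (radialPotential_nonneg _)]
  exact mul_le_of_le_one_right (abs_nonneg _) ((radialPotential_le _).trans (by norm_num))

lemma abs_radialMean_le {u : ℂ → ℝ} (hu : ContDiff ℝ 2 u) (hL : Integrable (Δ u)) {s : ℝ} (hs : 0 ≤ s) :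
    |radialMean u s| ≤ |radialMean u 0| + (∫ y, |(Δ u) y|) * s := by
  have h := (convex_univ (𝕜 := ℝ) (E := ℝ)).norm_image_sub_le_of_norm_hasDerivWithin_le
    (f := radialMean u) (C := ∫ y, |(Δ u) y|) (x := 0) (y := s)
    (fun x _ => (hasDerivAt_radialMean hu x).hasDerivWithinAt)
    (fun x _ => integral_laplacian_mul_le hL x) (mem_univ _) (mem_univ _)
  rw [sub_zero, Real.norm_eq_abs, Real.norm_eq_abs, abs_of_nonneg hs] at h
  have := abs_sub_abs_le_abs_sub (radialMean u s) (radialMean u 0)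
  linarith

/-- Green's formula at infinity: the total mass of the Laplacian determines the growth rate of the
averages. -/
lemma tendsto_radialMean_add_one_sub {u : ℂ → ℝ} (hu : ContDiff ℝ 2 u) (hL : Integrable (Δ u)) :
    Tendsto (fun s => radialMean u (s + 1) - radialMean u s) atTop (𝓝 ((∫ y, (Δ u) y) * (1 / 4))) := by
  have hlim : Tendsto (fun s => ∫ y, (Δ u) y * radialPotential (Real.exp (-s) • y)) atTop
      (𝓝 (∫ y, (Δ u) y * (1 / 4))) := by
    refine tendsto_integral_filter_of_dominated_convergence (fun y => |(Δ u) y|)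
      (Eventually.of_forall fun s => ?_) (Eventually.of_forall fun s => Eventually.of_forall fun y => ?_)
      hL.abs (Eventually.of_forall fun y => ?_)
    · exact (((continuous_laplacian hu).mul
        (continuous_radialPotential.comp (by fun_prop)))).aestronglyMeasurable
    · rw [norm_mul, Real.norm_eq_abs, Real.norm_eq_abs, abs_of_nonneg (radialPotential_nonneg _)]
      exact mul_le_of_le_one_right (abs_nonneg _) ((radialPotential_le _).trans (by norm_num))
    · refine Tendsto.const_mul _ ?_
      rw [← radialPotential_zero]
      refine (continuous_radialPotential.tendsto 0).comp ?_
      have := (Real.tendsto_exp_atBot.comp tendsto_neg_atTop_atBot).smul_const y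
      simpa using this
  rw [integral_mul_const] at hlim
  have hmv : ∀ s : ℝ, ∃ c ∈ Ioo s (s + 1), ∫ y, (Δ u) y * radialPotential (Real.exp (-c) • y) =
      radialMean u (s + 1) - radialMean u s := fun s => by
    obtain ⟨c, hc, h⟩ := exists_hasDerivAt_eq_slope (radialMean u) _ (lt_add_one s)
      (fun x _ => (hasDerivAt_radialMean hu x).continuousAt.continuousWithinAt)
      (fun x _ => hasDerivAt_radialMean hu x)
    exact ⟨c, hc, by rw [h]; simp⟩
  choose c hc h using hmv
  simp_rw [← h]
  exact hlim.comp (tendsto_atTop_mono (fun s => (hc s).1.le) tendsto_id)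

/-- The growth rate of the averages of a function with a logarithmic expansion at infinity. -/
lemma tendsto_radialMean_add_one_sub_of_log {u : ℂ → ℝ} (hu : Continuous u) {g a : ℝ}
    (h : Tendsto (fun z : ℂ => u z - (-g * Real.log ‖z‖ + a)) (Bornology.cobounded ℂ) (𝓝 0)) :
    Tendsto (fun s => radialMean u (s + 1) - radialMean u s) atTop (𝓝 (-g * (Real.pi / 2))) := by
  have hcob : ∀ c : ℝ, 0 < c → Tendsto (fun z : ℂ => c • z) (Bornology.cobounded ℂ)
      (Bornology.cobounded ℂ) := fun c hc => by
    rw [← tendsto_norm_atTop_iff_cobounded]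
    simp only [norm_smul]
    exact (tendsto_norm_cobounded_atTop).const_mul_atTop (norm_pos_iff.2 hc.ne')
  -- The dilation difference `u (e z) - u z` converges to `-g` at infinity; hence it is bounded.
  let d : ℂ → ℝ := fun z => u (Real.exp 1 • z) - u z
  have hd : Continuous d := by fun_prop
  have hdlim : Tendsto d (Bornology.cobounded ℂ) (𝓝 (-g)) := by
    have h1 := ((h.comp (hcob _ (Real.exp_pos 1))).sub h).add_const (-g)
    rw [sub_zero, zero_add] at h1
    refine h1.congr' ?_
    filter_upwards [Bornology.eventually_ne_cobounded (0 : ℂ)] with z hz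
    simp only [Function.comp_apply, norm_smul, Real.norm_of_nonneg (Real.exp_pos 1).le]
    rw [Real.log_mul (Real.exp_pos 1).ne' (norm_pos_iff.2 hz).ne', Real.log_exp]
    simp only [d]
    ring
  obtain ⟨C, hC⟩ : ∃ C, ∀ z, ‖d z‖ ≤ C := by
    have h1 : ∀ᶠ z in Bornology.cobounded ℂ, ‖d z‖ ≤ ‖-g‖ + 1 :=
      (hdlim.norm.eventually_lt_const (lt_add_one _)).mono fun _ h => h.le
    rw [Metric.cobounded_eq_cocompact] at h1
    obtain ⟨K, hK, hKd⟩ := mem_cocompact.1 h1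
    obtain ⟨C, hC⟩ := hK.exists_bound_of_continuousOn hd.continuousOn
    refine ⟨max C (‖-g‖ + 1), fun z => ?_⟩
    by_cases hz : z ∈ K
    · exact (hC z hz).trans (le_max_left _ _)
    · exact (hKd hz).trans (le_max_right _ _)
  have heq : ∀ s, radialMean u (s + 1) - radialMean u s = ∫ y, d (Real.exp s • y) * radialWeight y :=
    fun s => by
    unfold radialMean
    rw [← integral_sub (hu.integrable_comp_exp_smul_mul_radialWeight _)
      (hu.integrable_comp_exp_smul_mul_radialWeight _)]
    congr 1
    ext1 y
    simp only [d, smul_smul, ← Real.exp_add, add_comm 1 s, sub_mul]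
  simp_rw [heq]
  rw [← integral_radialWeight, ← integral_const_mul]
  refine tendsto_integral_filter_of_dominated_convergence (fun y => C * radialWeight y)
    (Eventually.of_forall fun s => (hd.integrable_comp_exp_smul_mul_radialWeight s).aestronglyMeasurable)
    (Eventually.of_forall fun s => Eventually.of_forall fun y => ?_)
    (integrable_radialWeight.const_mul C) ?_
  · rw [norm_mul, Real.norm_of_nonneg (radialWeight_nonneg y)]
    exact mul_le_mul_of_nonneg_right (hC _) (radialWeight_nonneg y)
  · filter_upwards [Measure.ae_ne volume (0 : ℂ)] with y hy
    refine Tendsto.mul_const _ (hdlim.comp ?_)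
    rw [← tendsto_norm_atTop_iff_cobounded]
    simp only [norm_smul, Real.norm_of_nonneg (Real.exp_pos _).le]
    exact Real.tendsto_exp_atTop.atTop_mul_const (norm_pos_iff.2 hy)

/-- The sub-mean value property. -/
lemma mul_apply_zero_le_radialMean {v : ℂ → ℝ} (hv : ContDiff ℝ 2 v) (hL : ∀ z, 0 ≤ (Δ v) z) (s : ℝ) :
    Real.pi / 2 * v 0 ≤ radialMean v s := by
  have hmono : Monotone (radialMean v) := monotone_of_hasDerivAt_nonneg
    (fun x => hasDerivAt_radialMean hv x) fun x => integral_nonneg fun y =>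
      mul_nonneg (hL y) (radialPotential_nonneg _)
  have hlim : Tendsto (radialMean v) atBot (𝓝 (∫ y, v 0 * radialWeight y)) := by
    obtain ⟨C, hC⟩ := (isCompact_closedBall (0 : ℂ) 1).exists_bound_of_continuousOn
      hv.continuous.continuousOn
    refine tendsto_integral_filter_of_dominated_convergence (fun y => C * radialWeight y)
      (Eventually.of_forall fun s =>
        (hv.continuous.integrable_comp_exp_smul_mul_radialWeight s).aestronglyMeasurable)
      ?_ (integrable_radialWeight.const_mul C) (Eventually.of_forall fun y => ?_)
    · filter_upwards [eventually_le_atBot 0] with s hs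
      refine Eventually.of_forall fun y => ?_
      rw [norm_mul, Real.norm_of_nonneg (radialWeight_nonneg y)]
      rcases le_total ‖y‖ 1 with hy | hy
      · refine mul_le_mul_of_nonneg_right (hC _ ?_) (radialWeight_nonneg y)
        rw [mem_closedBall_zero_iff, norm_smul, Real.norm_of_nonneg (Real.exp_pos _).le]
        exact mul_le_one₀ (Real.exp_le_one_iff.2 hs) (norm_nonneg _) hy
      · simp [radialWeight_eq_zero hy]
    · refine Tendsto.mul_const _ ((hv.continuous.tendsto 0).comp ?_)
      have := Real.tendsto_exp_atBot.smul_const y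
      simpa using this
  rw [integral_const_mul, integral_radialWeight, mul_comm] at hlim
  exact hmono.le_of_tendsto hlim s

/-- Positive parts are controlled by the integral of `e^u`, because `u⁺ ≤ e^u`; negative parts are then
controlled by the averages of `u`, which grow at most logarithmically by Green's formula. -/
lemma integral_abs_radialMean_le {u : ℂ → ℝ} (hu : ContDiff ℝ 2 u) (hL : Integrable (Δ u))
    (hE : Integrable fun z => Real.exp (u z)) :
    ∃ C, 0 ≤ C ∧ ∀ s, 0 ≤ s → radialMean (fun z => |u z|) s ≤ C * (1 + s) := by
  set A := ∫ z, Real.exp (u z)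
  set B := ∫ y, |(Δ u) y|
  have hA : 0 ≤ A := integral_nonneg fun _ => (Real.exp_pos _).le
  have hB : 0 ≤ B := integral_nonneg fun _ => abs_nonneg _
  refine ⟨2 * A + |radialMean u 0| + B, by positivity, fun s hs => ?_⟩
  have hc := hu.continuous
  have hexp : ∫ y, Real.exp (u (Real.exp s • y)) ≤ A := by
    rw [integral_exp_smul (fun y => Real.exp (u y))]
    exact mul_le_of_le_one_left hA (Real.exp_le_one_iff.2 (by linarith))
  have hexpi : Integrable fun y => Real.exp (u (Real.exp s • y)) :=
    hE.comp_smul (Real.exp_pos s).ne'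
  have h1 : radialMean (fun z => |u z|) s ≤
      ∫ y, (2 * Real.exp (u (Real.exp s • y)) - u (Real.exp s • y) * radialWeight y) := by
    refine integral_mono (hc.abs.integrable_comp_exp_smul_mul_radialWeight s)
      ((hexpi.const_mul 2).sub (hc.integrable_comp_exp_smul_mul_radialWeight s)) fun y => ?_
    have hw0 := radialWeight_nonneg y
    have hw1 := radialWeight_le_one y
    have he := Real.exp_pos (u (Real.exp s • y))
    have he1 := Real.add_one_le_exp (u (Real.exp s • y))
    change |u (Real.exp s • y)| * radialWeight y ≤
      2 * Real.exp (u (Real.exp s • y)) - u (Real.exp s • y) * radialWeight y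
    rcases le_total 0 (u (Real.exp s • y)) with h | h
    · rw [abs_of_nonneg h]; nlinarith
    · rw [abs_of_nonpos h]; nlinarith
  rw [integral_sub (hexpi.const_mul 2) (hc.integrable_comp_exp_smul_mul_radialWeight s),
    integral_const_mul] at h1
  have h2 := abs_radialMean_le hu hL hs
  have h3 : radialMean u s = ∫ y, u (Real.exp s • y) * radialWeight y := rfl
  rw [← h3] at h1
  have h4 := neg_abs_le (radialMean u s)
  have h5 : 0 ≤ (2 * A + |radialMean u 0|) * s := by positivity
  nlinarith

lemma laplacian_comp_add_left {v : ℂ → ℝ} (hv : ContDiff ℝ 2 v) (z x : ℂ) :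
    (Δ fun y => v (z + y)) x = (Δ v) (z + x) := by
  have h : ContDiff ℝ 2 fun y => v (z + y) := hv.comp (contDiff_const.add contDiff_id)
  have h1 : ∀ (f : ℂ → ℝ) (x e : ℂ), fderiv ℝ (fun y => f (z + y)) x e = fderiv ℝ f (z + x) e :=
    fun f x e => by rw [fderiv_comp_add_left]
  rw [laplacian_eq_fderiv_fderiv h, laplacian_eq_fderiv_fderiv hv]
  simp only [h1]
  rw [h1 (fun y => fderiv ℝ v y 1), h1 (fun y => fderiv ℝ v y Complex.I)]

/-- A subharmonic function whose averages in absolute value grow at most logarithmically in the radius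
grows at most logarithmically from above. -/
theorem le_log_of_subharmonic {v : ℂ → ℝ} (hv : ContDiff ℝ 2 v) (hL : ∀ z, 0 ≤ (Δ v) z) {C : ℝ}
    (hC0 : 0 ≤ C) (hC : ∀ s, 0 ≤ s → radialMean (fun z => |v z|) s ≤ C * (1 + s)) :
    ∃ K, 0 ≤ K ∧ ∀ z, v z ≤ K * (1 + Real.log (1 + ‖z‖)) := by
  refine ⟨2 / Real.pi * (4 / 3 * Real.exp 4 * (C * 3)), by positivity, fun z => ?_⟩
  -- The disc of radius `e^s` around `z` lies well inside the disc of radius `e^(s+2)` around `0`, where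
  -- the radial weight is at least `3/4`.
  set s := Real.log (1 + ‖z‖) with hs
  have hs0 : 0 ≤ s := Real.log_nonneg (by linarith [norm_nonneg z])
  have hes : Real.exp s = 1 + ‖z‖ := Real.exp_log (by positivity)
  have hc := hv.continuous
  have h1 := mul_apply_zero_le_radialMean (v := fun y => v (z + y))
    (hv.comp (contDiff_const.add contDiff_id)) (fun x => by
      rw [laplacian_comp_add_left hv]; exact hL _) s
  simp only [add_zero] at h1
  have hcs : HasCompactSupport fun x : ℂ => radialWeight (Real.exp (-s) • (x - z)) := by
    refine HasCompactSupport.intro (isCompact_closedBall z (Real.exp s)) fun x hx =>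
      radialWeight_eq_zero ?_
    rw [norm_smul, Real.norm_of_nonneg (Real.exp_pos _).le, Real.exp_neg, ← div_eq_inv_mul,
      one_le_div (Real.exp_pos _)]
    exact (not_le.1 fun h => hx (by simpa [dist_eq_norm] using h)).le
  have h2 : radialMean (fun y => v (z + y)) s =
      Real.exp (-(2 * s)) * ∫ x, v x * radialWeight (Real.exp (-s) • (x - z)) := by
    have e1 := integral_exp_smul (fun y => v (z + y) * radialWeight (Real.exp (-s) • y)) s
    simp only [smul_smul, ← Real.exp_add, neg_add_cancel, Real.exp_zero, one_smul] at e1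
    have e2 := integral_add_left_eq_self (μ := (volume : Measure ℂ))
      (fun x => v x * radialWeight (Real.exp (-s) • (x - z))) z
    simp only [add_sub_cancel_left] at e2
    rw [← e2, ← e1]
    rfl
  have h3 : radialMean (fun z => |v z|) (s + 2) =
      Real.exp (-(2 * (s + 2))) * ∫ x, |v x| * radialWeight (Real.exp (-(s + 2)) • x) := by
    have e1 := integral_exp_smul (fun y => |v y| * radialWeight (Real.exp (-(s + 2)) • y)) (s + 2)
    simp only [smul_smul, ← Real.exp_add, neg_add_cancel, Real.exp_zero, one_smul] at e1
    exact e1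
  have hcs2 : HasCompactSupport fun x : ℂ => radialWeight (Real.exp (-(s + 2)) • x) :=
    hasCompactSupport_radialWeight.comp_smul (Real.exp_pos _).ne'
  have h4 : ∫ x, v x * radialWeight (Real.exp (-s) • (x - z)) ≤
      4 / 3 * ∫ x, |v x| * radialWeight (Real.exp (-(s + 2)) • x) := by
    rw [← integral_const_mul]
    refine integral_mono
      ((hc.mul (continuous_radialWeight.comp (by fun_prop))).integrable_of_hasCompactSupport hcs.mul_left)
      (((hc.abs.mul (continuous_radialWeight.comp (by fun_prop))).integrable_of_hasCompactSupport
        hcs2.mul_left).const_mul _) fun x => ?_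
    have key : radialWeight (Real.exp (-s) • (x - z)) ≤
        4 / 3 * radialWeight (Real.exp (-(s + 2)) • x) := by
      rcases le_total (Real.exp s) ‖x - z‖ with hx | hx
      · rw [radialWeight_eq_zero]
        · exact mul_nonneg (by norm_num) (radialWeight_nonneg _)
        · rw [norm_smul, Real.norm_of_nonneg (Real.exp_pos _).le, Real.exp_neg, ← div_eq_inv_mul]
          exact (one_le_div (Real.exp_pos _)).2 hx
      · have hx2 : ‖x‖ ≤ 2 * Real.exp s := by
          have := norm_le_norm_add_norm_sub' x z
          linarith
        have he2 : 4 ≤ Real.exp 2 := by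
          have h := Real.add_one_le_exp (1 : ℝ)
          have : Real.exp 2 = Real.exp 1 * Real.exp 1 := by rw [← Real.exp_add]; norm_num
          nlinarith
        have hn : ‖Real.exp (-(s + 2)) • x‖ ≤ 1 / 2 := by
          rw [norm_smul, Real.norm_of_nonneg (Real.exp_pos _).le, Real.exp_neg, ← div_eq_inv_mul,
            div_le_iff₀ (Real.exp_pos _), Real.exp_add]
          nlinarith [Real.exp_pos s]
        have hw : 3 / 4 ≤ radialWeight (Real.exp (-(s + 2)) • x) :=
          le_max_of_le_left (by nlinarith [norm_nonneg (Real.exp (-(s + 2)) • x)])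
        linarith [radialWeight_le_one (Real.exp (-s) • (x - z))]
    have hw := radialWeight_nonneg (Real.exp (-s) • (x - z))
    change v x * radialWeight (Real.exp (-s) • (x - z)) ≤
      4 / 3 * (|v x| * radialWeight (Real.exp (-(s + 2)) • x))
    calc v x * radialWeight (Real.exp (-s) • (x - z)) ≤ |v x| * radialWeight (Real.exp (-s) • (x - z)) :=
          mul_le_mul_of_nonneg_right (le_abs_self _) hw
      _ ≤ |v x| * (4 / 3 * radialWeight (Real.exp (-(s + 2)) • x)) :=
          mul_le_mul_of_nonneg_left key (abs_nonneg _)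
      _ = _ := by ring
  have h5 : Real.exp (-(2 * s)) * ∫ x, v x * radialWeight (Real.exp (-s) • (x - z)) ≤
      4 / 3 * Real.exp 4 * radialMean (fun z => |v z|) (s + 2) := by
    rw [h3]
    calc _ ≤ Real.exp (-(2 * s)) * (4 / 3 * ∫ x, |v x| * radialWeight (Real.exp (-(s + 2)) • x)) :=
          mul_le_mul_of_nonneg_left h4 (Real.exp_pos _).le
      _ = _ := by
          rw [show -(2 * s) = 4 + -(2 * (s + 2)) by ring, Real.exp_add]
          ring
  have h6 := hC (s + 2) (by linarith)
  rw [h2] at h1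
  have h7 : Real.pi / 2 * v z ≤ 4 / 3 * Real.exp 4 * (C * 3) * (1 + s) := by
    refine h1.trans (h5.trans ?_)
    rw [mul_assoc _ (C * 3)]
    refine mul_le_mul_of_nonneg_left (h6.trans ?_) (by positivity)
    nlinarith
  have hpi := Real.pi_pos
  calc v z = 2 / Real.pi * (Real.pi / 2 * v z) := by field_simp
    _ ≤ 2 / Real.pi * (4 / 3 * Real.exp 4 * (C * 3) * (1 + s)) :=
        mul_le_mul_of_nonneg_left h7 (by positivity)
    _ = _ := by ring

end MeanGrowth

/-! ### Expansions at infinity -/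

section PolynomialGrowth

/-- Liouville's theorem for entire functions of polynomial growth. -/
theorem exists_polynomial_of_growth {f : ℂ → ℂ} (hf : Differentiable ℂ f) {A : ℝ} {m : ℕ}
    (hA : ∀ z, ‖f z‖ ≤ A * (1 + ‖z‖) ^ m) : ∃ p : Polynomial ℂ, ∀ z, f z = p.eval z := by
  have hA0 : 0 ≤ A := by simpa using (norm_nonneg _).trans (hA 0)
  have hzero : ∀ n, m < n → iteratedDeriv n f 0 = 0 := fun n hn => by
    have hb : ∀ R : ℝ, 1 ≤ R → ‖iteratedDeriv n f 0‖ ≤ n.factorial * (A * 2 ^ m) * R⁻¹ := fun R hR => by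
      have hR0 : 0 < R := by linarith
      have h := Complex.norm_iteratedDeriv_le_of_forall_mem_sphere_norm_le (c := 0)
        (C := A * (2 * R) ^ m) n hR0 hf.diffContOnCl fun z hz => by
          have hz' : ‖z‖ = R := by simpa using hz
          refine (hA z).trans ?_
          rw [hz']
          gcongr
          linarith
      refine h.trans ?_
      rw [mul_pow, div_le_iff₀ (by positivity)]
      have h2 : R ^ m ≤ R⁻¹ * R ^ n := by
        obtain ⟨j, rfl⟩ : ∃ j, n = m + 1 + j := ⟨n - (m + 1), by omega⟩
        have : R⁻¹ * R ^ (m + 1 + j) = R ^ m * R ^ j := by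
          rw [pow_add, pow_succ]; field_simp
        rw [this]
        exact le_mul_of_one_le_right (by positivity) (one_le_pow₀ hR)
      calc (n.factorial : ℝ) * (A * (2 ^ m * R ^ m)) = n.factorial * (A * 2 ^ m) * R ^ m := by ring
        _ ≤ n.factorial * (A * 2 ^ m) * (R⁻¹ * R ^ n) := by gcongr
        _ = _ := by ring
    have hlim : Tendsto (fun R : ℝ => n.factorial * (A * 2 ^ m) * R⁻¹) atTop (𝓝 0) := by
      simpa using tendsto_inv_atTop_zero.const_mul ((n.factorial : ℝ) * (A * 2 ^ m))
    exact norm_le_zero_iff.1 (ge_of_tendsto hlim ((eventually_ge_atTop 1).mono hb))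
  refine ⟨∑ n ∈ Finset.range (m + 1), Polynomial.C ((n.factorial : ℂ)⁻¹ * iteratedDeriv n f 0)
    * Polynomial.X ^ n, fun z => ?_⟩
  have h1 := Complex.hasSum_taylorSeries_of_entire hf 0 z
  have h2 := hasSum_sum_of_ne_finset_zero (L := SummationFilter.unconditional ℕ) (s := Finset.range (m + 1))
    (f := fun n : ℕ => (n.factorial : ℂ)⁻¹ • (z - 0) ^ n • iteratedDeriv n f 0) fun n hn => by
      rw [hzero n (by simpa using hn)]; simp
  rw [h1.unique h2, Polynomial.eval_finsetSum]
  refine Finset.sum_congr rfl fun n _ => ?_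
  simp
  ring

/-- The logarithm of a sum of squared absolute values of polynomials has an expansion at infinity whose
leading coefficient is twice the largest degree. After the substitution `z = ζ⁻¹` the expansion is the
differentiability of the logarithm at `ζ = 0`. -/
theorem log_sum_norm_sq_polynomial {ι : Type*} [Fintype ι] (p : ι → Polynomial ℂ) (hp : ∃ i, p i ≠ 0) :
    ∃ (d : ℕ) (c : ℝ), (fun z : ℂ => Real.log (∑ i, ‖(p i).eval z‖ ^ 2) - (2 * d * Real.log ‖z‖ + c))
      =O[Bornology.cobounded ℂ] fun z => ‖z‖⁻¹ := by
  obtain ⟨i₀, hi₀⟩ := hp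
  have hne : (Finset.univ.filter fun i => p i ≠ 0).Nonempty := ⟨i₀, by simpa using hi₀⟩
  obtain ⟨j, hj, hmax⟩ := Finset.exists_max_image _ (fun i => (p i).natDegree) hne
  set d := (p j).natDegree with hd
  have hdeg : ∀ i, (p i).natDegree ≤ d := fun i => by
    by_cases hi : p i = 0
    · simp [hi]
    · exact hmax i (by simpa using hi)
  let G : ℂ → ℝ := fun ζ => ∑ i, ‖((p i).reflect d).eval ζ‖ ^ 2
  have hG0 : 0 < G 0 := by
    refine Finset.sum_pos' (fun i _ => by positivity) ⟨j, Finset.mem_univ _, ?_⟩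
    rw [← Polynomial.coeff_zero_eq_eval_zero, Polynomial.coeff_reflect, Polynomial.revAt_zero]
    have : (p j).coeff d ≠ 0 := by
      rw [hd]; exact Polynomial.leadingCoeff_ne_zero.2 (by simpa using hj)
    positivity
  have hGd : DifferentiableAt ℝ (fun ζ => Real.log (G ζ)) 0 := by
    refine DifferentiableAt.log (DifferentiableAt.fun_sum fun i _ => ?_) hG0.ne'
    exact (((p i).reflect d).differentiable.differentiableAt.restrictScalars ℝ).norm_sq ℝ
  refine ⟨d, Real.log (G 0), ?_⟩
  have hO := hGd.hasFDerivAt.isBigO_sub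
  have hinv : Tendsto (fun z : ℂ => z⁻¹) (Bornology.cobounded ℂ) (𝓝 0) := tendsto_inv₀_cobounded
  have h1 := hO.comp_tendsto hinv
  have hpos : ∀ᶠ z : ℂ in Bornology.cobounded ℂ, 0 < G z⁻¹ := by
    have hGc : ContinuousAt G 0 := by
      refine Continuous.continuousAt (continuous_finsetSum _ fun i _ => ?_)
      exact ((Polynomial.continuous _).norm).pow 2
    exact (hGc.tendsto.comp hinv).eventually_const_lt hG0
  refine Asymptotics.IsBigO.congr' (Asymptotics.isBigO_norm_right.2 h1) ?_ ?_
  · filter_upwards [hpos, Bornology.eventually_ne_cobounded (0 : ℂ)] with z hz hz0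
    have heval : ∀ i, ‖(p i).eval z‖ ^ 2 = ‖((p i).reflect d).eval z⁻¹‖ ^ 2 * ‖z‖ ^ (2 * d) := fun i => by
      let _ : Invertible z := invertibleOfNonzero hz0
      have h := Polynomial.eval₂_reflect_mul_pow (RingHom.id ℂ) z d (p i) (hdeg i)
      simp only [Polynomial.eval₂_id, invOf_eq_inv] at h
      rw [← h, norm_mul, norm_pow, mul_pow, ← pow_mul, mul_comm d 2]
    have hsum : ∑ i, ‖(p i).eval z‖ ^ 2 = G z⁻¹ * ‖z‖ ^ (2 * d) := by
      simp only [heval, G, Finset.sum_mul]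
    rw [hsum, Real.log_mul hz.ne' (pow_ne_zero _ (norm_ne_zero_iff.2 hz0)), Real.log_pow]
    simp only [Function.comp_apply]
    push_cast
    ring
  · exact Eventually.of_forall fun z => by simp

/-- A function with logarithmic expansion `-g log |z| + a` at infinity and integrable exponential has
`g > 2`, because `|z|⁻²` is not integrable at infinity in the plane. -/
theorem two_lt_of_integrable_exp {u : ℂ → ℝ} (hE : Integrable fun z => Real.exp (u z)) {g a : ℝ}
    (h : Tendsto (fun z : ℂ => u z - (-g * Real.log ‖z‖ + a)) (Bornology.cobounded ℂ) (𝓝 0)) : 2 < g := by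
  by_contra! hg
  -- If `g ≤ 2`, then `|z|⁻²` is dominated by a multiple of `e^u` near infinity.
  have h1 : ∀ᶠ z in Bornology.cobounded ℂ, -1 < u z - (-g * Real.log ‖z‖ + a) :=
    h.eventually_const_lt (by norm_num)
  obtain ⟨R, hR, hR'⟩ : ∃ R : ℝ, 1 ≤ R ∧ ∀ z : ℂ, R < ‖z‖ → -1 < u z - (-g * Real.log ‖z‖ + a) := by
    rw [← comap_norm_atTop, eventually_comap] at h1
    obtain ⟨R, hR⟩ := eventually_atTop.1 h1
    exact ⟨max R 1, le_max_right _ _, fun z hz => hR ‖z‖ ((le_max_left _ _).trans hz.le) z rfl⟩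
  let f : ℝ → ℝ := (Ioi R).indicator fun r => (r ^ 2)⁻¹
  have hfm : Measurable f := ((measurable_id.pow_const 2).inv).indicator measurableSet_Ioi
  have hint : Integrable (fun z : ℂ => f ‖z‖) := by
    refine (hE.const_mul (Real.exp (1 - a))).mono (hfm.comp measurable_norm).aestronglyMeasurable
      (Eventually.of_forall fun z => ?_)
    by_cases hz : R < ‖z‖
    · have hz0 : 0 < ‖z‖ := by linarith
      have hlog : 0 ≤ Real.log ‖z‖ := Real.log_nonneg (by linarith)
      have e1 : f ‖z‖ = Real.exp (-(2 * Real.log ‖z‖)) := by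
        simp only [f, indicator_of_mem (mem_Ioi.2 hz)]
        rw [Real.exp_neg, show (2 : ℝ) * Real.log ‖z‖ = Real.log (‖z‖ ^ 2) by simp,
          Real.exp_log (by positivity)]
      rw [e1, ← Real.exp_add, Real.norm_of_nonneg (Real.exp_pos _).le,
        Real.norm_of_nonneg (Real.exp_pos _).le, Real.exp_le_exp]
      have := hR' z hz
      nlinarith
    · simp only [f, indicator_of_notMem (fun h => hz (mem_Ioi.1 h))]
      rw [norm_zero]
      positivity
  rw [integrable_fun_norm_addHaar, Complex.finrank_real_complex] at hint
  refine not_integrableOn_Ioi_inv (a := R) ((hint.mono_set (Ioi_subset_Ioi (by linarith))).congr_fun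
    (fun r hr => ?_) measurableSet_Ioi)
  have hr0 : r ≠ 0 := by have := mem_Ioi.1 hr; linarith
  simp only [f, indicator_of_mem hr, smul_eq_mul, Nat.add_one_sub_one, pow_one]
  field_simp

end PolynomialGrowth

/-! ### The Toda lattice -/

lemma laplacian_sum_mul {ι : Type*} (s : Finset ι) (c : ι → ℝ) {f : ι → ℂ → ℝ}
    (hf : ∀ i, ContDiff ℝ 2 (f i)) (z : ℂ) :
    (Δ fun z => ∑ i ∈ s, c i * f i z) z = ∑ i ∈ s, c i * (Δ (f i)) z := by
  classical
  induction s using Finset.induction_on with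
  | empty => simp
  | insert a s ha ih =>
    have h1 : (fun z => ∑ i ∈ insert a s, c i * f i z) = c a • f a + fun z => ∑ i ∈ s, c i * f i z := by
      ext z; simp [Finset.sum_insert ha]
    rw [h1, ContDiffAt.laplacian_add, InnerProductSpace.laplacian_smul, Finset.sum_insert ha, ih]
    · simp
    · exact (hf a).contDiffAt
    · exact ((hf a).const_smul (c a)).contDiffAt
    · exact (ContDiff.sum fun i _ => contDiff_const.mul (hf i)).contDiffAt

/-- The function is continuous, and the averages of its absolute value over discs around `0` grow at most
logarithmically in the radius. -/
def HasLogMean (f : ℂ → ℝ) : Prop :=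
  Continuous f ∧ ∃ C, 0 ≤ C ∧ ∀ s, 0 ≤ s → radialMean (fun z => |f z|) s ≤ C * (1 + s)

lemma HasLogMean.sum_mul {ι : Type*} (t : Finset ι) (c : ι → ℝ) {f : ι → ℂ → ℝ}
    (hf : ∀ i, HasLogMean (f i)) : HasLogMean fun z => ∑ i ∈ t, c i * f i z := by
  have hcont : Continuous fun z => ∑ i ∈ t, c i * f i z :=
    continuous_finsetSum _ fun i _ => continuous_const.mul (hf i).1
  choose hc C hC0 hC using hf
  refine ⟨hcont, ∑ i ∈ t, |c i| * C i, Finset.sum_nonneg fun i _ => mul_nonneg (abs_nonneg _) (hC0 i),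
    fun s hs => ?_⟩
  have hint : ∀ i, Integrable fun y => |c i| * (|f i (Real.exp s • y)| * radialWeight y) := fun i =>
    ((hc i).abs.integrable_comp_exp_smul_mul_radialWeight s).const_mul _
  calc radialMean (fun z => |∑ i ∈ t, c i * f i z|) s
      ≤ ∫ y, ∑ i ∈ t, |c i| * (|f i (Real.exp s • y)| * radialWeight y) := by
        refine integral_mono (hcont.abs.integrable_comp_exp_smul_mul_radialWeight s)
          (integrable_finsetSum _ fun i _ => hint i) fun y => ?_
        simp only [← mul_assoc, ← Finset.sum_mul, ← abs_mul]
        exact mul_le_mul_of_nonneg_right (Finset.abs_sum_le_sum_abs _ _) (radialWeight_nonneg y)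
    _ = ∑ i ∈ t, |c i| * radialMean (fun z => |f i z|) s := by
        rw [integral_finsetSum _ fun i _ => hint i]
        simp only [integral_const_mul]
        rfl
    _ ≤ ∑ i ∈ t, |c i| * (C i * (1 + s)) :=
        Finset.sum_le_sum fun i _ => mul_le_mul_of_nonneg_left (hC i s hs) (abs_nonneg _)
    _ = (∑ i ∈ t, |c i| * C i) * (1 + s) := by
        rw [Finset.sum_mul]; exact Finset.sum_congr rfl fun i _ => by ring

/-- Summation by parts with linear weights. -/
lemma sum_range_sub_mul_sub (d : ℕ → ℝ) (M : ℕ) :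
    ∑ j ∈ Finset.range M, ((M : ℝ) - j) * (d j - d (j + 1)) =
      M * d 0 - ∑ j ∈ Finset.range M, d (j + 1) := by
  induction M with
  | zero => simp
  | succ M ih =>
    have h : ∑ j ∈ Finset.range M, (((M + 1 : ℕ) : ℝ) - j) * (d j - d (j + 1)) =
        ∑ j ∈ Finset.range M, ((M : ℝ) - j) * (d j - d (j + 1))
          + ∑ j ∈ Finset.range M, (d j - d (j + 1)) := by
      rw [← Finset.sum_add_distrib]
      exact Finset.sum_congr rfl fun j _ => by push_cast; ring
    rw [Finset.sum_range_succ, h, ih, Finset.sum_range_sub', Finset.sum_range_succ]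
    push_cast
    ring

section TodaSolution

variable {N : ℕ}

/-- The components `u_1, …, u_N`, extended by zero to all indices; the indices start at `0`. -/
noncomputable def todaExtend (u : Fin N → ℂ → ℝ) (j : ℕ) : ℂ → ℝ :=
  if h : j < N then u ⟨j, h⟩ else 0

/-- `todaDensity u k` is `e^{u_k}` for `1 ≤ k ≤ N`, and zero for the other indices. -/
noncomputable def todaDensity (u : Fin N → ℂ → ℝ) (k : ℕ) (z : ℂ) : ℝ :=
  if h : 1 ≤ k ∧ k ≤ N then Real.exp (u ⟨k - 1, by omega⟩ z) else 0

/-- The coefficients of the trace-free diagonal part of the Toda lattice in terms of the `u_j`. -/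
noncomputable def todaCoeff (N k j : ℕ) : ℝ := ((N : ℝ) - j) / (N + 1) - if j < k then 1 else 0

/-- The functions `t_0, …, t_N` with `t_k - t_{k+1} = u_{k+1}` and `t_0 + ⋯ + t_N = 0`, which turn the
Toda system into the open Toda lattice. -/
noncomputable def todaDiag (u : Fin N → ℂ → ℝ) (k : ℕ) (z : ℂ) : ℝ :=
  ∑ j ∈ Finset.range N, todaCoeff N k j * todaExtend u j z

lemma todaDensity_zero (u : Fin N → ℂ → ℝ) (z : ℂ) : todaDensity u 0 z = 0 := by simp [todaDensity]

lemma todaDensity_top (u : Fin N → ℂ → ℝ) (z : ℂ) : todaDensity u (N + 1) z = 0 := by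
  simp [todaDensity]

lemma todaDensity_succ (u : Fin N → ℂ → ℝ) (i : Fin N) (z : ℂ) :
    todaDensity u (i + 1) z = Real.exp (u i z) := by
  simp [todaDensity]

lemma todaDensity_nonneg (u : Fin N → ℂ → ℝ) (k : ℕ) (z : ℂ) : 0 ≤ todaDensity u k z := by
  unfold todaDensity; split_ifs <;> positivity

lemma todaExtend_val (u : Fin N → ℂ → ℝ) (i : Fin N) : todaExtend u i = u i := by simp [todaExtend]

lemma contDiff_todaExtend {u : Fin N → ℂ → ℝ} (hu : ∀ i, ContDiff ℝ 2 (u i)) (j : ℕ) :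
    ContDiff ℝ 2 (todaExtend u j) := by
  unfold todaExtend
  split_ifs
  · exact hu _
  · exact contDiff_const

lemma contDiff_todaDiag {u : Fin N → ℂ → ℝ} (hu : ∀ i, ContDiff ℝ 2 (u i)) (k : ℕ) :
    ContDiff ℝ 2 (todaDiag u k) :=
  ContDiff.sum fun j _ => contDiff_const.mul (contDiff_todaExtend hu j)

lemma todaDiag_sub_succ (u : Fin N → ℂ → ℝ) (i : Fin N) (z : ℂ) :
    todaDiag u i z - todaDiag u (i + 1) z = u i z := by
  unfold todaDiag
  rw [← Finset.sum_sub_distrib, Finset.sum_eq_single (i : ℕ)]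
  · rw [← sub_mul]; simp [todaCoeff, todaExtend_val]
  · intro j _ hj
    rw [← sub_mul]
    have : (j < (i : ℕ) + 1) ↔ j < (i : ℕ) := by omega
    simp [todaCoeff, this]
  · intro h; exact absurd (Finset.mem_range.2 i.2) h

lemma sum_cartanMatrix_mul (u : Fin N → ℂ → ℝ) (i : Fin N) (z : ℂ) :
    ∑ j, (CartanMatrix.A N i j : ℝ) * Real.exp (u j z) =
      2 * todaDensity u (i + 1) z - todaDensity u i z - todaDensity u (i + 2) z := by
  have h : ∀ j : Fin N, (CartanMatrix.A N i j : ℝ) * Real.exp (u j z) =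
      (if j = i then 2 * todaDensity u (i + 1) z else 0) - (if (j : ℕ) + 1 = i then todaDensity u i z else 0)
        - (if (j : ℕ) = i + 1 then todaDensity u (i + 2) z else 0) := fun j => by
    simp only [CartanMatrix.A, Matrix.of_apply]
    by_cases h1 : j = i
    · subst h1
      simp [todaDensity_succ]
    · have hji : ¬ i = j := fun h => h1 h.symm
      have hv : (j : ℕ) ≠ i := fun h => h1 (Fin.ext h)
      by_cases h2 : (j : ℕ) + 1 = i
      · have h3 : ¬ (j : ℕ) = i + 1 := by omega
        rw [← h2, todaDensity_succ]
        simp [h1, hji, h2, h3]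
      · by_cases h3 : (j : ℕ) = i + 1
        · have h4 : todaDensity u (i + 2) z = Real.exp (u j z) := by
            rw [show (i : ℕ) + 2 = j + 1 by omega, todaDensity_succ]
          have h5 : ¬ (i : ℕ) + 1 + 1 = i := by omega
          simp [h1, hji, h3, h4, h5]
        · have h4 : ¬ (i : ℕ) + 1 = j := fun h => h3 h.symm
          simp [h1, hji, h2, h3, h4]
  simp only [h, Finset.sum_sub_distrib, Finset.sum_ite_eq', Finset.mem_univ, if_true]
  congr 1
  · congr 1
    by_cases h0 : (i : ℕ) = 0
    · simp [h0, todaDensity_zero]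
    · rw [Finset.sum_eq_single (⟨i - 1, by omega⟩ : Fin N)]
      · rw [if_pos]; simp only; omega
      · intro j _ hj
        rw [if_neg]
        intro h; apply hj; ext; simp only; omega
      · simp
  · by_cases h0 : (i : ℕ) + 1 < N
    · rw [Finset.sum_eq_single (⟨i + 1, h0⟩ : Fin N)]
      · simp
      · intro j _ hj
        rw [if_neg]
        intro h; exact hj (Fin.ext h)
      · simp
    · have : (i : ℕ) + 2 = N + 1 := by omega
      rw [this, todaDensity_top]
      simp

lemma laplacian_eq_of_isTodaSolution {u : Fin N → ℂ → ℝ} (hu : IsTodaSolution u) (i : Fin N) (z : ℂ) :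
    (Δ (u i)) z = -2 * ∑ j, (CartanMatrix.A N i j : ℝ) * Real.exp (u j z) := by
  rw [← hu.eqn i z]; ring

/-- The functions `t_k` solve the open Toda lattice. -/
lemma laplacian_todaDiag {u : Fin N → ℂ → ℝ} (hu : IsTodaSolution u) {k : ℕ} (hk : k ≤ N) (z : ℂ) :
    (Δ (todaDiag u k)) z = 2 * (todaDensity u k z - todaDensity u (k + 1) z) := by
  let d : ℕ → ℝ := fun j => todaDensity u (j + 1) z - todaDensity u j z
  have h1 : (Δ (todaDiag u k)) z = ∑ j ∈ Finset.range N, todaCoeff N k j * (-2 * (d j - d (j + 1))) := by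
    refine (laplacian_sum_mul _ _ (contDiff_todaExtend hu.contDiff) z).trans
      (Finset.sum_congr rfl fun j hj => ?_)
    have hjN := Finset.mem_range.1 hj
    have : todaExtend u j = u ⟨j, hjN⟩ := todaExtend_val u ⟨j, hjN⟩
    rw [this, laplacian_eq_of_isTodaSolution hu, sum_cartanMatrix_mul]
    simp only [d]
    ring
  have h2 : ∑ j ∈ Finset.range N, (if j < k then (1 : ℝ) else 0) * (d j - d (j + 1)) = d 0 - d k := by
    simp only [ite_mul, one_mul, zero_mul]
    rw [← Finset.sum_filter]
    have : (Finset.range N).filter (· < k) = Finset.range k := by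
      ext j; simp only [Finset.mem_filter, Finset.mem_range]; omega
    rw [this, Finset.sum_range_sub']
  have h3 : ∑ j ∈ Finset.range N, d (j + 1) = -todaDensity u 1 z := by
    have h : ∀ j, d (j + 1) = todaDensity u (j + 1 + 1) z - todaDensity u (j + 1) z := fun j => rfl
    simp only [h]
    rw [Finset.sum_range_sub (fun j => todaDensity u (j + 1) z), todaDensity_top]
    simp
  have h4 := sum_range_sub_mul_sub d N
  have h5 : ∑ j ∈ Finset.range N, todaCoeff N k j * (-2 * (d j - d (j + 1))) =
      -2 / (N + 1) * (∑ j ∈ Finset.range N, ((N : ℝ) - j) * (d j - d (j + 1)))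
        + 2 * ∑ j ∈ Finset.range N, (if j < k then (1 : ℝ) else 0) * (d j - d (j + 1)) := by
    rw [Finset.mul_sum, Finset.mul_sum, ← Finset.sum_add_distrib]
    refine Finset.sum_congr rfl fun j _ => ?_
    unfold todaCoeff
    ring
  rw [h1, h5, h4, h2, h3]
  simp only [d, todaDensity_zero, zero_add]
  field_simp
  ring

lemma sum_todaOff_sq_left (u : Fin N → ℂ → ℝ) (a : Fin (N + 1)) (z : ℂ) :
    ∑ j, todaOff (fun a : Fin (N + 1) => todaDiag u a) z j a ^ 2 = todaDensity u a z / 2 := by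
  have hs : ∀ i : Fin N, ((√2)⁻¹ * Real.exp ((todaDiag u i z - todaDiag u (i + 1) z) / 2)) ^ 2 =
      todaDensity u (i + 1) z / 2 := fun i => by
    rw [todaDiag_sub_succ, todaDensity_succ, mul_pow, inv_pow, Real.sq_sqrt (by norm_num),
      ← Real.exp_nat_mul]
    push_cast
    rw [mul_div_cancel₀ _ (two_ne_zero' ℝ)]
    ring
  rcases Fin.eq_zero_or_eq_succ a with rfl | ⟨i, rfl⟩
  · simp [todaOff, todaDensity_zero]
  · rw [Finset.sum_eq_single i.castSucc]
    · simpa [todaOff] using hs i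
    · intro j _ hj
      have : ¬ (j : ℕ) = i := fun h => hj (Fin.ext h)
      simp [todaOff, this]
    · simp

lemma sum_todaOff_sq_right (u : Fin N → ℂ → ℝ) (a : Fin (N + 1)) (z : ℂ) :
    ∑ j, todaOff (fun a : Fin (N + 1) => todaDiag u a) z a j ^ 2 = todaDensity u (a + 1) z / 2 := by
  by_cases ha : (a : ℕ) < N
  · let b : Fin (N + 1) := ⟨a + 1, by omega⟩
    have h1 : ∑ j, todaOff (fun a : Fin (N + 1) => todaDiag u a) z a j ^ 2 =
        todaOff (fun a : Fin (N + 1) => todaDiag u a) z a b ^ 2 := by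
      refine Finset.sum_eq_single b (fun j _ hj => ?_) (by simp)
      have : ¬ ((a : ℕ) + 1 = j) := fun h => hj (Fin.ext h.symm)
      simp [todaOff, this]
    have h2 : ∑ j, todaOff (fun a : Fin (N + 1) => todaDiag u a) z j b ^ 2 =
        todaOff (fun a : Fin (N + 1) => todaDiag u a) z a b ^ 2 := by
      refine Finset.sum_eq_single a (fun j _ hj => ?_) (by simp)
      have : ¬ ((j : ℕ) + 1 = b) := fun h => hj (Fin.ext (by simpa [b] using h))
      simp [todaOff, this]
    rw [h1, ← h2, sum_todaOff_sq_left]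
  · have haN : (a : ℕ) = N := by omega
    rw [haN, todaDensity_top, zero_div]
    refine Finset.sum_eq_zero fun j _ => ?_
    have : ¬ ((a : ℕ) + 1 = j) := by omega
    simp [todaOff, this]

lemma integrable_laplacian {u : Fin N → ℂ → ℝ} (hu : IsTodaSolution u) (hE : HasFiniteEnergy u)
    (i : Fin N) : Integrable (Δ (u i)) := by
  have : Δ (u i) = fun z => -2 * ∑ j, (CartanMatrix.A N i j : ℝ) * Real.exp (u j z) :=
    funext fun z => laplacian_eq_of_isTodaSolution hu i z
  rw [this]
  exact (integrable_finsetSum _ fun j _ => (hE j).const_mul _).const_mul _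

lemma integral_laplacian {u : Fin N → ℂ → ℝ} (hu : IsTodaSolution u) (hE : HasFiniteEnergy u)
    (i : Fin N) : ∫ z, (Δ (u i)) z = -2 * Real.pi * todaGamma u i := by
  simp only [laplacian_eq_of_isTodaSolution hu]
  rw [integral_const_mul, integral_finsetSum _ fun j _ => (hE j).const_mul _]
  simp only [integral_const_mul, todaGamma]
  have := Real.pi_pos.ne'
  field_simp

lemma hasLogMean_todaDiag {u : Fin N → ℂ → ℝ} (hu : IsTodaSolution u) (hE : HasFiniteEnergy u) (k : ℕ) :
    HasLogMean (todaDiag u k) := by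
  refine HasLogMean.sum_mul _ _ fun j => ?_
  unfold todaExtend
  split_ifs with h
  · exact ⟨(hu.contDiff _).continuous,
      integral_abs_radialMean_le (hu.contDiff _) (integrable_laplacian hu hE _) (hE _)⟩
  · exact ⟨continuous_const, 0, le_rfl, fun s _ => by simp [radialMean]⟩

/-- The function `-(t_0 + ⋯ + t_{k-1})` is subharmonic, with Laplacian `2 e^{u_k}`; so it is bounded from
above by a multiple of the logarithm. -/
lemma neg_sum_todaDiag_le_log {u : Fin N → ℂ → ℝ} (hu : IsTodaSolution u) (hE : HasFiniteEnergy u)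
    {k : ℕ} (hk : k ≤ N + 1) :
    ∃ K, 0 ≤ K ∧ ∀ z, -∑ a ∈ Finset.range k, todaDiag u a z ≤ K * (1 + Real.log (1 + ‖z‖)) := by
  have hneg : ∀ z, -∑ a ∈ Finset.range k, todaDiag u a z =
      ∑ a ∈ Finset.range k, (-1 : ℝ) * todaDiag u a z := fun z => by simp
  obtain ⟨-, C, hC0, hC⟩ := HasLogMean.sum_mul (Finset.range k) (fun _ => (-1 : ℝ))
    (hasLogMean_todaDiag hu hE)
  simp only [hneg]
  refine le_log_of_subharmonic
    (ContDiff.sum fun a _ => contDiff_const.mul (contDiff_todaDiag hu.contDiff a)) (fun z => ?_) hC0 hC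
  rw [laplacian_sum_mul _ _ fun a => contDiff_todaDiag hu.contDiff a]
  have h : ∑ a ∈ Finset.range k, (-1 : ℝ) * (Δ (todaDiag u a)) z =
      -2 * ∑ a ∈ Finset.range k, (todaDensity u a z - todaDensity u (a + 1) z) := by
    rw [Finset.mul_sum]
    refine Finset.sum_congr rfl fun a ha => ?_
    rw [laplacian_todaDiag hu (by have := Finset.mem_range.1 ha; omega)]
    ring
  rw [h, Finset.sum_range_sub' (fun a => todaDensity u a z), todaDensity_zero]
  linarith [todaDensity_nonneg u k z]

/-- The functions `-(t_0 + ⋯ + t_{k-1})` have logarithmic expansions at infinity, because their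
exponentials are sums of squared absolute values of polynomials. -/
theorem neg_sum_todaDiag_expansion {u : Fin N → ℂ → ℝ} (hu : IsTodaSolution u) (hE : HasFiniteEnergy u)
    {k : ℕ} (hk : k ≤ N + 1) :
    ∃ g c : ℝ, (fun z : ℂ => -∑ a ∈ Finset.range k, todaDiag u a z - (g * Real.log ‖z‖ + c))
      =O[Bornology.cobounded ℂ] fun z => ‖z‖⁻¹ := by
  obtain ⟨D, hD, hsum⟩ := exists_entire_sum_norm_sq (t := fun a : Fin (N + 1) => todaDiag u a)
    (fun a => contDiff_todaDiag hu.contDiff a) (fun a z => by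
      rw [sum_todaOff_sq_left, sum_todaOff_sq_right, laplacian_todaDiag hu (by omega)]
      ring) hk
  have hfin : ∀ z, ∑ a : Fin k, todaDiag u (Fin.castLE hk a) z = ∑ a ∈ Finset.range k, todaDiag u a z :=
    fun z => by rw [← Fin.sum_univ_eq_sum_range (fun a => todaDiag u a z)]; rfl
  simp only [hfin] at hsum
  obtain ⟨K, hK0, hK⟩ := neg_sum_todaDiag_le_log hu hE hk
  have hkpos : (0 : ℝ) < k.factorial := by exact_mod_cast k.factorial_pos
  have hpoly : ∀ p, ∃ P : Polynomial ℂ, ∀ z, D p z = P.eval z := fun p => by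
    refine exists_polynomial_of_growth (hD p) (A := 1 + k.factorial * Real.exp K) (m := ⌈K⌉₊) fun z => ?_
    have h1 : ‖D p z‖ ^ 2 ≤ k.factorial * Real.exp (-∑ a ∈ Finset.range k, todaDiag u a z) := by
      rw [← hsum]
      exact Finset.single_le_sum (f := fun p => ‖D p z‖ ^ 2) (fun p _ => by positivity)
        (Finset.mem_univ p)
    have hz1 : 1 ≤ 1 + ‖z‖ := by linarith [norm_nonneg z]
    have h2 : Real.exp (-∑ a ∈ Finset.range k, todaDiag u a z) ≤ Real.exp K * (1 + ‖z‖) ^ ⌈K⌉₊ := by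
      rw [← Real.exp_log (show 0 < 1 + ‖z‖ by linarith), ← Real.exp_nat_mul, ← Real.exp_add,
        Real.exp_le_exp]
      refine (hK z).trans ?_
      have h3 := mul_le_mul_of_nonneg_right (Nat.le_ceil K) (Real.log_nonneg hz1)
      linarith
    have h4 : 1 ≤ (1 + ‖z‖) ^ ⌈K⌉₊ := one_le_pow₀ hz1
    calc ‖D p z‖ ≤ 1 + ‖D p z‖ ^ 2 := by nlinarith [sq_nonneg (‖D p z‖ - 1)]
      _ ≤ (1 + ‖z‖) ^ ⌈K⌉₊ + k.factorial * (Real.exp K * (1 + ‖z‖) ^ ⌈K⌉₊) :=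
          add_le_add h4 (h1.trans (mul_le_mul_of_nonneg_left h2 hkpos.le))
      _ = _ := by ring
  choose P hP using hpoly
  have hne : ∃ p, P p ≠ 0 := by
    by_contra! h
    have h1 := hsum 0
    simp only [hP, h, Polynomial.eval_zero, norm_zero] at h1
    have h2 : 0 < k.factorial * Real.exp (-∑ a ∈ Finset.range k, todaDiag u a 0) := by positivity
    rw [← h1] at h2
    simp at h2
  obtain ⟨d, c, hO⟩ := log_sum_norm_sq_polynomial P hne
  refine ⟨2 * d, c - Real.log k.factorial, hO.congr_left fun z => ?_⟩
  simp only [← hP]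
  rw [hsum, Real.log_mul hkpos.ne' (Real.exp_pos _).ne', Real.log_exp]
  ring

end TodaSolution

/-! ### The asymptotic expansion -/

theorem lemma2p1 (N : ℕ) (hN : 0 < N) (u : Fin N → ℂ → ℝ)
    (hu : IsTodaSolution u) (hE : HasFiniteEnergy u) :
    (∀ i : Fin N, ∃ a : ℝ,
      (fun z : ℂ => u i z - (-todaGamma u i * Real.log ‖z‖ + a))
        =O[Bornology.cobounded ℂ] (fun z : ℂ => ‖z‖⁻¹)) ∧
    (∀ i : Fin N, 2 < todaGamma u i) := by
  have hinv : Tendsto (fun z : ℂ => ‖z‖⁻¹) (Bornology.cobounded ℂ) (𝓝 0) :=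
    tendsto_inv_atTop_zero.comp tendsto_norm_cobounded_atTop
  have main : ∀ i : Fin N, ∃ a : ℝ, (fun z : ℂ => u i z - (-todaGamma u i * Real.log ‖z‖ + a))
      =O[Bornology.cobounded ℂ] (fun z : ℂ => ‖z‖⁻¹) := fun i => by
    obtain ⟨g0, c0, h0⟩ := neg_sum_todaDiag_expansion hu hE (k := i) (by omega)
    obtain ⟨g1, c1, h1⟩ := neg_sum_todaDiag_expansion hu hE (k := i + 1) (by omega)
    obtain ⟨g2, c2, h2⟩ := neg_sum_todaDiag_expansion hu hE (k := i + 2) (by omega)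
    have h : (fun z : ℂ => u i z - (-(2 * g1 - g0 - g2) * Real.log ‖z‖ + (c0 + c2 - 2 * c1)))
        =O[Bornology.cobounded ℂ] (fun z : ℂ => ‖z‖⁻¹) := by
      refine ((h0.add h2).sub (h1.const_mul_left 2)).congr_left fun z => ?_
      rw [Finset.sum_range_succ _ ((i : ℕ) + 1), Finset.sum_range_succ, ← todaDiag_sub_succ u i z]
      ring
    -- The growth rate of the averages identifies the leading coefficient with `γ_i`.
    have e1 := tendsto_radialMean_add_one_sub_of_log (hu.contDiff i).continuous (h.trans_tendsto hinv)
    have e2 := tendsto_radialMean_add_one_sub (hu.contDiff i) (integrable_laplacian hu hE i)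
    have e3 := tendsto_nhds_unique e1 e2
    rw [integral_laplacian hu hE] at e3
    have hg : 2 * g1 - g0 - g2 = todaGamma u i := by
      have hpi := Real.pi_pos
      have : (2 * g1 - g0 - g2 - todaGamma u i) * (Real.pi / 2) = 0 := by linear_combination -e3
      rcases mul_eq_zero.1 this with h | h
      · linarith
      · linarith
    exact ⟨_, hg ▸ h⟩
  refine ⟨main, fun i => ?_⟩
  obtain ⟨a, ha⟩ := main i
  exact two_lt_of_integrable_exp (hE i) (ha.trans_tendsto hinv)
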